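/- Let $p\ge q\ge 0$ be integers with $d=p+q>2$, let $\eta$ be the bilinear form $\operatorname{diag}(1,\dots,1,-1,\dots,-1)$ of signature $(p+1,q+1)$ on $\mathbb R^{d+2}$ (coordinates $0,\dots,d+1$), and let $G=SO(p+1,q+1)_0$ be the identity component of its special orthogonal group, acting on $\mathbb{RP}^{d+1}$. Put $o=(1:0:1)$, $\infty=(1:0:-1)$ (coordinates split as $1+d+1$), and let $Q\le G$ be the stabiliser of $o$. A tuple $([v_1],\dots,[v_m])$ of $\eta$-isotropic lines is in *general position* if $v_1,\dots,v_m$ are linearly independent and $\eta(v_i,v_j)\neq 0$ for all $i\ne j$. Let $$U=\{(g_1,\dots,g_4)\in G^4 : (g_1o,\dots,g_4o)\text{ in general position}\},\qquad \tilde G=\{g\in G : (o,\infty,go,g\infty)\text{ in general position}\}.$$ Let $D_0=E_{0,d+1}+E_{d+1,0}\in\mathfrak g=\mathfrak{so}(p+1,q+1)$, $\mathfrak a=\mathbb RD_0$, let $A=\exp\mathfrak a$, and let $M={}^0Z_G(\mathfrak a)$, that is, the group generated by (in fact, equal to the set of) the products $k\exp X$ with $k\in Z_G(\mathfrak a)$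 an orthogonal matrix and $X\in[\mathfrak z,\mathfrak z]$ a symmetric matrix, where $\mathfrak z=Z_{\mathfrak g}(\mathfrak a)$. Let $MA$ be the subgroup generated by $M$ and $A$ (the set of products $ma$). Let $\mathbb K\in\{\mathbb R,\mathbb C\}$, let $(V_i,\pi_i)$, $i=1,\dots,4$, be representations of $Q$ on finite-dimensional $\mathbb K$-vector spaces, and $W=V_1\otimes\cdots\otimes V_4$. A function $f:U\to W$ *satisfies the Ward identities* if it is smooth and $$f(gg_1q_1,\dots,gg_4q_4)=\bigl(\pi_1(q_1)^{-1}\otimes\cdots\otimes\pi_4(q_4)^{-1}\bigr)f(g_1,\dots,g_4)\qquad (g\in G,\ q_i\in Q,\ (g_1,\dots,g_4)\in U).$$ **Theorem.** (0) There is a diagonal matrix $w\in G$ with $w^2=1$, $wo=\infty$, $w\infty=o$. Let $w\in G$ be any element with $w^2=1$, $wo=\infty$, $w\infty=o$. (1) The formulas $$h\cdot(v_1\otimes v_2\otimes v_3\otimes v_4)=\pi_1(h)v_1\otimes \pi_2(whw)v_2\otimes v_3\otimes v_4,$$ $$(v_1\otimes v_2\otimes v_3\otimes v_4)\cdot h=v_1\otimes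 v_2\otimes \pi_3(h^{-1})v_3\otimes\pi_4(wh^{-1}w)v_4\qquad(h\in MA)$$ make $W$ an $MA$-bimodule, with smooth actions if all $\pi_i$ are smooth. If $f:U\to W$ satisfies the Ward identities, then $F:\tilde G\to W$, $F(g)=f(1,w,g,gw)$, is a matrix-spherical function for $MA$ and these actions: $h\tilde Gh'\subseteq\tilde G$, $F$ is smooth, and $F(hgh')=h\cdot F(g)\cdot h'$ for all $h,h'\in MA$ and $g\in\tilde G$. (2) The map $f\mapsto F$ is injective on the set of functions $f:U\to W$ that satisfy the Ward identities. (3) $(G,MA)$ is a symmetric pair: conjugation with $\operatorname{diag}(-1,1,\dots,1,-1)$ is an involutive automorphism $\sigma$ of the topological group $G$, and $(G^\sigma)_0\le MA\le G^\sigma$, where $G^\sigma$ is the fixed point subgroup and $(G^\sigma)_0$ its identity component. -/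

import Mathlib

open scoped Matrix LinearAlgebra.Projectivization TensorProduct ContDiff

noncomputable section

namespace ConformalWard

/-- Indices `0, …, d + 1` (`d = p + q`) of the coordinates of `ℝ^{p+1,q+1}`: the left summand holds
the `p + 1` positive directions `0, …, p`, the right one the `q + 1` negative ones. -/
abbrev Idx (p q : ℕ) : Type := Fin (p + 1) ⊕ Fin (q + 1)

/-- The index `0`. -/
abbrev i0 (p q : ℕ) : Idx p q := Sum.inl 0

/-- The index `d + 1`. -/
abbrev iLast (p q : ℕ) : Idx p q := Sum.inr (Fin.last q)

/-- The Gram matrix `diag(1, …, 1, -1, …, -1)` of the standard form of signature `(p+1, q+1)`. -/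
abbrev gram (p q : ℕ) : Matrix (Idx p q) (Idx p q) ℝ :=
  LieAlgebra.Orthogonal.indefiniteDiagonal (Fin (p + 1)) (Fin (q + 1)) ℝ

/-- The standard bilinear form `η` of signature `(p+1, q+1)`. -/
def eta (p q : ℕ) (x y : Idx p q → ℝ) : ℝ := x ⬝ᵥ (gram p q *ᵥ y)

/-- The group `SO(p+1, q+1)`. -/
def indefiniteSO (p q : ℕ) : Subgroup (Matrix.SpecialLinearGroup (Idx p q) ℝ) where
  carrier := {g | (g : Matrix (Idx p q) (Idx p q) ℝ)ᵀ * gram p q * g = gram p q}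
  one_mem' := by simp
  mul_mem' := by
    intro a b ha hb
    simp only [Set.mem_ofPred_eq] at ha hb ⊢
    calc _ = (b : Matrix (Idx p q) (Idx p q) ℝ)ᵀ *
          ((a : Matrix (Idx p q) (Idx p q) ℝ)ᵀ * gram p q * a) * b := by
          simp [Matrix.mul_assoc]
      _ = _ := by rw [ha, hb]
  inv_mem' := by
    intro a ha
    simp only [Set.mem_ofPred_eq] at ha ⊢
    have h1 : (a : Matrix (Idx p q) (Idx p q) ℝ) *
        (a⁻¹ : Matrix.SpecialLinearGroup (Idx p q) ℝ) = 1 := by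
      rw [← Matrix.SpecialLinearGroup.coe_mul, mul_inv_cancel, Matrix.SpecialLinearGroup.coe_one]
    have h2 := congrArg Matrix.transpose h1
    rw [Matrix.transpose_mul, Matrix.transpose_one] at h2
    nth_rewrite 1 [← ha]
    set b := ((a⁻¹ : Matrix.SpecialLinearGroup (Idx p q) ℝ) : Matrix (Idx p q) (Idx p q) ℝ)
    set a' := (a : Matrix (Idx p q) (Idx p q) ℝ)
    calc bᵀ * (a'ᵀ * gram p q * a') * b = (bᵀ * a'ᵀ) * gram p q * (a' * b) := by
          simp only [Matrix.mul_assoc]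
      _ = _ := by rw [h1, h2]; simp

/-- The conformal group `G = SO(p+1, q+1)₀`, the identity component of `SO(p+1, q+1)`. -/
def confGroup (p q : ℕ) : Subgroup (Matrix.SpecialLinearGroup (Idx p q) ℝ) :=
  (Subgroup.connectedComponentOfOne (indefiniteSO p q)).map (indefiniteSO p q).subtype

/-- The group `G` as a type. It acts on projective space `ℙ ℝ (ℝ^{d+2})` by `g • [v] = [g v]`. -/
abbrev G (p q : ℕ) : Type := confGroup p q

/-- The underlying matrix of an element of `G`. -/
abbrev mat {p q : ℕ} (g : G p q) : Matrix (Idx p q) (Idx p q) ℝ := g.1.1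

/-! ### Points and point configurations -/

/-- The vector `e₀ + e_{d+1}`. -/
def originVec (p q : ℕ) : Idx p q → ℝ := Pi.single (i0 p q) 1 + Pi.single (iLast p q) 1

/-- The vector `e₀ - e_{d+1}`. -/
def inftyVec (p q : ℕ) : Idx p q → ℝ := Pi.single (i0 p q) 1 - Pi.single (iLast p q) 1

lemma originVec_ne_zero (p q : ℕ) : originVec p q ≠ 0 := fun h => by
  simpa [originVec] using congrFun h (i0 p q)

lemma inftyVec_ne_zero (p q : ℕ) : inftyVec p q ≠ 0 := fun h => by
  simpa [inftyVec] using congrFun h (i0 p q)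

/-- The point `ι(0) = (1 : 0 : 1)` of the conformal compactification. -/
def origin (p q : ℕ) : ℙ ℝ (Idx p q → ℝ) := Projectivization.mk ℝ _ (originVec_ne_zero p q)

/-- The point `∞ = (1 : 0 : -1)` of the conformal compactification. -/
def infty (p q : ℕ) : ℙ ℝ (Idx p q → ℝ) := Projectivization.mk ℝ _ (inftyVec_ne_zero p q)

/-- A tuple of points of the conformal compactification (the quadric `η(v, v) = 0`) is in general
position if representing vectors are linearly independent and pairwise non-orthogonal. Neither
condition depends on the choice of the representatives. -/
structure GeneralPosition {p q m : ℕ} (x : Fin m → ℙ ℝ (Idx p q → ℝ)) : Prop where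
  isotropic : ∀ i, eta p q (x i).rep (x i).rep = 0
  independent : Projectivization.Independent x
  nonorthogonal : ∀ i j, i ≠ j → eta p q (x i).rep (x j).rep ≠ 0

/-- The stabiliser `Q` of `ι(0)` in `G`. -/
def Q (p q : ℕ) : Subgroup (G p q) := MulAction.stabilizer (G p q) (origin p q)

/-- `U ⊆ G⁴`: the preimage of the set of quadruples in general position under
`G⁴ → (G/Q)⁴`, where `gQ` is identified with the point `g • ι(0)`. -/
def U (p q : ℕ) : Set (Fin 4 → G p q) := {g | GeneralPosition fun i => g i • origin p q}

/-- `G̃ ⊆ G`: the set of those `g` for which `(ι(0), ∞, g ι(0), g ∞)` is in general position. -/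
def Gtilde (p q : ℕ) : Set (G p q) :=
  {g | GeneralPosition ![origin p q, infty p q, g • origin p q, g • infty p q]}

/-! ### The subgroups `M` and `A` -/

/-- The element `D₀` of the Lie algebra of `G`; it spans `𝔞`. -/
def D0 (p q : ℕ) : Matrix (Idx p q) (Idx p q) ℝ :=
  Matrix.single (i0 p q) (iLast p q) 1 + Matrix.single (iLast p q) (i0 p q) 1

/-- The Lie algebra `𝔤 = 𝔰𝔬(p+1, q+1)` of `G`. -/
abbrev lieG (p q : ℕ) : Submodule ℝ (Matrix (Idx p q) (Idx p q) ℝ) :=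
  skewAdjointMatricesSubmodule (gram p q)

/-- `A`: the analytic subgroup of `G` with Lie algebra `𝔞 = ℝ D₀`, i.e. the subgroup
generated by `exp 𝔞`. -/
def A (p q : ℕ) : Subgroup (G p q) :=
  Subgroup.closure {g | ∃ t : ℝ, mat g = NormedSpace.exp (t • D0 p q)}

/-- The derived algebra `[𝔷, 𝔷]` of the centraliser `𝔷 = Z_𝔤(𝔞)`, as a subspace of matrices. -/
def derivedCentralizer (p q : ℕ) : Submodule ℝ (Matrix (Idx p q) (Idx p q) ℝ) :=
  Submodule.span ℝ {Z | ∃ X ∈ lieG p q, ∃ Y ∈ lieG p q,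
    Commute X (D0 p q) ∧ Commute Y (D0 p q) ∧ Z = X * Y - Y * X}

/-- `M = ⁰Z_G(𝔞)`. For a reductive group `L` with maximal compact subgroup `K_L` and Cartan
decomposition `𝔩 = 𝔨_L ⊕ 𝔭_L` one puts `⁰L = K_L exp(𝔭_L ∩ [𝔩, 𝔩])`; here `L = Z_G(𝔞)`,
`K_L` consists of the orthogonal matrices in `L`, and `𝔭_L` of the symmetric matrices in
`𝔩 = 𝔷`. The set of these products is itself a group, so that taking the subgroup generated by it
does not enlarge it. -/
def M (p q : ℕ) : Subgroup (G p q) :=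
  Subgroup.closure {g | ∃ k : G p q, ∃ X : Matrix (Idx p q) (Idx p q) ℝ,
    (mat k)ᵀ * mat k = 1 ∧ Commute (mat k) (D0 p q) ∧
    Xᵀ = X ∧ X ∈ derivedCentralizer p q ∧ mat g = mat k * NormedSpace.exp X}

/-- The subgroup `MA` of `G`. (As `A` centralises `M`, the join is the set of products `ma`.) -/
def MA (p q : ℕ) : Subgroup (G p q) := M p q ⊔ A p q

/-! ### `MA` fixes `ι(0)` and `∞` -/

lemma commute_of_mem_derivedCentralizer {p q : ℕ} {X : Matrix (Idx p q) (Idx p q) ℝ}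
    (hX : X ∈ derivedCentralizer p q) : Commute X (D0 p q) := by
  induction hX using Submodule.span_induction with
  | mem x h =>
    obtain ⟨X, -, Y, -, hX, hY, rfl⟩ := h
    exact (hX.mul_left hY).sub_left (hY.mul_left hX)
  | zero => exact Commute.zero_left _
  | add x y _ _ hx hy => exact hx.add_left hy
  | smul a x _ hx => exact hx.smul_left a

/-- The elements of `G` that centralise `𝔞`. -/
lemma commute_of_mem_MA {p q : ℕ} {h : G p q} (hh : h ∈ MA p q) :
    Commute (mat h) (D0 p q) := by
  let Z : Subgroup (G p q) :=
    { carrier := {g | Commute (mat g) (D0 p q)}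
      one_mem' := Commute.one_left _
      mul_mem' := fun {a b} ha hb => Commute.mul_left (a := mat a) (b := mat b) ha hb
      inv_mem' := by
        intro a ha
        have h1 : mat a * mat a⁻¹ = 1 := congrArg mat (mul_inv_cancel a)
        have h2 : mat a⁻¹ * mat a = 1 := congrArg mat (inv_mul_cancel a)
        change mat a * D0 p q = D0 p q * mat a at ha
        change mat a⁻¹ * D0 p q = D0 p q * mat a⁻¹
        calc mat a⁻¹ * D0 p q = mat a⁻¹ * (D0 p q * mat a) * mat a⁻¹ := by
              rw [Matrix.mul_assoc, Matrix.mul_assoc, h1, Matrix.mul_one]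
          _ = D0 p q * mat a⁻¹ := by
              rw [← ha, ← Matrix.mul_assoc, h2, Matrix.one_mul] }
  have hZ : MA p q ≤ Z := by
    refine sup_le ((Subgroup.closure_le _).2 ?_) ((Subgroup.closure_le _).2 ?_)
    · rintro g ⟨k, X, -, hk, -, hX, hg⟩
      change Commute (mat g) _
      rw [hg]
      exact hk.mul_left (commute_of_mem_derivedCentralizer hX).exp_left
    · rintro g ⟨t, hg⟩
      change Commute (mat g) _
      rw [hg]
      exact ((Commute.refl (D0 p q)).smul_left t).exp_left
  exact hZ hh

lemma D0_mulVec {p q : ℕ} (v : Idx p q → ℝ) :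
    D0 p q *ᵥ v = Pi.single (i0 p q) (v (iLast p q)) + Pi.single (iLast p q) (v (i0 p q)) := by
  simp [D0, Matrix.add_mulVec, Matrix.single_mulVec, Pi.single]

lemma MA_smul_origin {p q : ℕ} {h : G p q} (hh : h ∈ MA p q) :
    h • origin p q = origin p q := by
  have hc : mat h * D0 p q = D0 p q * mat h := commute_of_mem_MA hh
  have hD : D0 p q *ᵥ originVec p q = originVec p q := by
    rw [D0_mulVec]; simp [originVec]
  have key : D0 p q *ᵥ (mat h *ᵥ originVec p q) = mat h *ᵥ originVec p q := by
    rw [Matrix.mulVec_mulVec, ← hc, ← Matrix.mulVec_mulVec, hD]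
  set v := mat h *ᵥ originVec p q with hv
  refine (Projectivization.mk_eq_mk_iff' ℝ v _ _ _).2 ⟨v (i0 p q), ?_⟩
  have hl : v (iLast p q) = v (i0 p q) := by
    have := congrFun key (iLast p q)
    rw [D0_mulVec] at this
    simpa using this.symm
  nth_rewrite 2 [← key]
  rw [D0_mulVec, hl, originVec, smul_add, ← Pi.single_smul, ← Pi.single_smul, smul_eq_mul, mul_one]

lemma MA_smul_infty {p q : ℕ} {h : G p q} (hh : h ∈ MA p q) :
    h • infty p q = infty p q := by
  have hc : mat h * D0 p q = D0 p q * mat h := commute_of_mem_MA hh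
  have hD : D0 p q *ᵥ inftyVec p q = -inftyVec p q := by
    rw [D0_mulVec]; simp [inftyVec, Pi.single_neg, sub_eq_add_neg, add_comm]
  have key : D0 p q *ᵥ (mat h *ᵥ inftyVec p q) = -(mat h *ᵥ inftyVec p q) := by
    rw [Matrix.mulVec_mulVec, ← hc, ← Matrix.mulVec_mulVec, hD, Matrix.mulVec_neg]
  set v := mat h *ᵥ inftyVec p q with hv
  refine (Projectivization.mk_eq_mk_iff' ℝ v _ _ _).2 ⟨v (i0 p q), ?_⟩
  have hl : v (iLast p q) = -v (i0 p q) := by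
    have := congrFun key (iLast p q)
    rw [D0_mulVec] at this
    have h2 : v (i0 p q) = -v (iLast p q) := by simpa using this
    rw [h2, neg_neg]
  have h3 : v = -(D0 p q *ᵥ v) := by rw [key, neg_neg]
  nth_rewrite 2 [h3]
  rw [D0_mulVec, hl, inftyVec, smul_sub, ← Pi.single_smul, ← Pi.single_smul, smul_eq_mul, mul_one,
    Pi.single_neg, neg_add, neg_neg, sub_eq_add_neg]

/-! ### Smoothness -/

/-- `f : S → W` is smooth, where the set `S` is embedded by `emb` in the real normed space `E`,
and `W` is a finite-dimensional vector space: every coordinate of `f` is near each point the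
restriction of a `C^∞` function on an open subset of `E`. When `emb` identifies `S` with an
embedded submanifold of `E`, these are the smooth functions on this manifold. -/
def IsSmooth (𝕜 : Type*) [RCLike 𝕜] {S E W : Type*} [NormedAddCommGroup E] [NormedSpace ℝ E]
    [AddCommGroup W] [Module 𝕜 W] (emb : S → E) (f : S → W) : Prop :=
  ∀ (ℓ : Module.Dual 𝕜 W) (x : S), ∃ N : Set E, IsOpen N ∧ emb x ∈ N ∧
    ∃ φ : E → 𝕜, ContDiffOn ℝ ∞ φ N ∧ ∀ y : S, emb y ∈ N → ℓ (f y) = φ (emb y)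

/-- The entries of an element of `G`, as a point of the space of all real matrices, which is
normed by the maximum of the absolute values of the entries. -/
def entries {p q : ℕ} (g : G p q) : Idx p q → Idx p q → ℝ := fun a b => mat g a b

/-! ### Ward identities and matrix-spherical functions -/

section

variable {p q : ℕ} {𝕜 : Type*} [RCLike 𝕜] {V : Fin 4 → Type*}
  [∀ i, AddCommGroup (V i)] [∀ i, Module 𝕜 (V i)]

/-- The action `π₁(q₁) ⊗ ⋯ ⊗ π₄(q₄)` of `Q⁴` on `V₁ ⊗ ⋯ ⊗ V₄`. -/
def tensorRep (π : ∀ i, Representation 𝕜 (Q p q) (V i)) :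
    Representation 𝕜 (Fin 4 → Q p q) (⨂[𝕜] i, V i) :=
  PiTensorProduct.mapMonoidHom.comp
    (MonoidHom.pi fun i => (π i).comp (Pi.evalMonoidHom (fun _ : Fin 4 => Q p q) i))

/-- A function `f : U → V₁ ⊗ ⋯ ⊗ V₄` satisfies the Ward identities: it is smooth, and
`f(g g₁ q₁, …, g g₄ q₄) = π₁(q₁)⁻¹ ⊗ ⋯ ⊗ π₄(q₄)⁻¹ f(g₁, …, g₄)`. -/
structure SatisfiesWard (π : ∀ i, Representation 𝕜 (Q p q) (V i))
    (f : U p q → ⨂[𝕜] i, V i) : Prop where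
  smooth : IsSmooth 𝕜 (fun (x : U p q) i => entries (x.1 i)) f
  equivariant : ∀ (g : G p q) (k : Fin 4 → Q p q) (x y : U p q),
    (∀ i, y.1 i = g * x.1 i * (k i : G p q)) → f y = tensorRep π k⁻¹ (f x)

/-- `F : D → W` is a matrix-spherical function for the subgroup `H` of `G`, the left action `L` and
the right action `R` of `H` on `W`: the two actions make `W` an `H`-bimodule, the domain
`D ⊆ G` is stable under multiplication by `H` from both sides, `F` is smooth, and
`F(h g h') = h · F(g) · h'`. -/
structure IsMatrixSpherical {W : Type*} [AddCommGroup W] [Module 𝕜 W] (H : Subgroup (G p q))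
    (L : Representation 𝕜 H W) (R : Representation 𝕜 Hᵐᵒᵖ W) (D : Set (G p q)) (F : D → W) :
    Prop where
  bimodule : ∀ (h h' : H) (v : W),
    L h (R (MulOpposite.op h') v) = R (MulOpposite.op h') (L h v)
  invariant : ∀ h h' : H, ∀ g ∈ D, (h : G p q) * g * h' ∈ D
  smooth : IsSmooth 𝕜 (fun g : D => entries g.1) F
  equivariant : ∀ (h h' : H) (g : G p q) (hg : g ∈ D),
    F ⟨h * g * h', invariant h h' g hg⟩ = L h (R (MulOpposite.op h') (F ⟨g, hg⟩))

/-- `w` is an involution in `G` that interchanges `ι(0)` and `∞`. -/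
structure IsInversion (w : G p q) : Prop where
  mul_self : w * w = 1
  smul_origin : w • origin p q = infty p q
  smul_infty : w • infty p q = origin p q

/-- The inclusion `MA → Q`. -/
def inclMA (p q : ℕ) : MA p q →* Q p q where
  toFun h := ⟨h, MA_smul_origin h.2⟩
  map_one' := rfl
  map_mul' _ _ := rfl

/-- The homomorphism `MA → Q`, `h ↦ w h w`. -/
def conjMA {w : G p q} (hw : IsInversion w) : MA p q →* Q p q where
  toFun h := ⟨w * h * w, by
    change (w * (h : G p q) * w) • origin p q = origin p q
    rw [mul_smul, mul_smul, hw.smul_origin, MA_smul_infty h.2, hw.smul_infty]⟩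
  map_one' := Subtype.ext (by simp [hw.mul_self])
  map_mul' a b := Subtype.ext (by
    change w * ((a : G p q) * b) * w = w * a * w * (w * b * w)
    calc w * ((a : G p q) * b) * w = w * a * 1 * b * w := by simp only [mul_assoc, one_mul]
      _ = _ := by rw [← hw.mul_self]; simp only [mul_assoc])

/-- The left action `h · (v₁ ⊗ v₂ ⊗ v₃ ⊗ v₄) = (h v₁) ⊗ (w h w v₂) ⊗ v₃ ⊗ v₄` of `MA`. -/
def leftAction (π : ∀ i, Representation 𝕜 (Q p q) (V i)) {w : G p q} (hw : IsInversion w) :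
    Representation 𝕜 (MA p q) (⨂[𝕜] i, V i) :=
  (tensorRep π).comp (MonoidHom.pi ![inclMA p q, conjMA hw, 1, 1])

/-- The right action `(v₁ ⊗ v₂ ⊗ v₃ ⊗ v₄) · h = v₁ ⊗ v₂ ⊗ (h⁻¹ v₃) ⊗ (w h⁻¹ w v₄)` of `MA`, as a
representation of the opposite group. -/
def rightAction (π : ∀ i, Representation 𝕜 (Q p q) (V i)) {w : G p q} (hw : IsInversion w) :
    Representation 𝕜 (MA p q)ᵐᵒᵖ (⨂[𝕜] i, V i) :=
  ((tensorRep π).comp (MonoidHom.pi ![1, 1, inclMA p q, conjMA hw])).comp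
    (MulEquiv.inv' (MA p q)).symm.toMonoidHom

lemma mem_U_of_mem_Gtilde {w : G p q} (hw : IsInversion w) {g : G p q} (hg : g ∈ Gtilde p q) :
    (![1, w, g, g * w] : Fin 4 → G p q) ∈ U p q := by
  have h : (fun i => (![1, w, g, g * w] : Fin 4 → G p q) i • origin p q) =
      ![origin p q, infty p q, g • origin p q, g • infty p q] := by
    funext i
    fin_cases i <;> simp [hw.smul_origin, mul_smul]
  change GeneralPosition fun i => (![1, w, g, g * w] : Fin 4 → G p q) i • origin p q
  rw [h]
  exact hg

/-- The map `f ↦ F`, `F(g) = f(1, w, g, g w)` for `g ∈ G̃`. -/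
def toSpherical {W : Type*} {w : G p q} (hw : IsInversion w) (f : U p q → W) : Gtilde p q → W :=
  fun g => f ⟨![1, w, g, g * w], mem_U_of_mem_Gtilde hw g.2⟩

end

/-! ### Symmetric pairs -/

/-- The subgroup `G^σ` of fixed points. -/
def fixedSubgroup {Γ : Type*} [Group Γ] (σ : Γ →* Γ) : Subgroup Γ := σ.eqLocus (MonoidHom.id Γ)

/-- `(Γ, H)` is a symmetric pair with respect to the automorphism `σ`: `σ` is an involution and
`(Γ^σ)₀ ≤ H ≤ Γ^σ`. -/
structure IsSymmetricPair {Γ : Type*} [Group Γ] [TopologicalSpace Γ] [IsTopologicalGroup Γ]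
    (σ : Γ ≃ₜ* Γ) (H : Subgroup Γ) : Prop where
  involutive : Function.Involutive σ
  component_le : (Subgroup.connectedComponentOfOne (fixedSubgroup (σ : Γ →* Γ))).map
    (fixedSubgroup (σ : Γ →* Γ)).subtype ≤ H
  le_fixed : H ≤ fixedSubgroup (σ : Γ →* Γ)

/-- The matrix `diag(-1, 1, …, 1, -1)`. -/
def reflMatrix (p q : ℕ) : Matrix (Idx p q) (Idx p q) ℝ :=
  Matrix.diagonal fun i => if i = i0 p q ∨ i = iLast p q then -1 else 1

end ConformalWard

end

/-!
Everything rests on three facts about `G`, the identity component of `SO(p+1, q+1)`.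

A matrix lies in `G` as soon as it is joined to the identity by a path of matrices that preserve
`η` (`exists_mat_eq_of_continuous`). This puts rotations (hence the diagonal involution `w`),
Eichler transformations and exponentials of symmetric elements of the Lie algebra into `G`.

`G` acts transitively on pairs of non-orthogonal isotropic lines
(`exists_smul_origin_infty_eq`). Eichler transformations suffice: those of an isotropic
vector `a` fix `a` and are transitive on the isotropic lines not orthogonal to `a`
(`exists_fix_and_map`). Applied to the first two and to the last two points of a configuration, this
writes every element of `U` as `a (1, w, g, g w) (k₁, …, k₄)` with `g ∈ G̃` and `kᵢ ∈ Q`, so that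
the Ward identities recover `f` from `F` (`injOn_toSpherical`). The equivariance of `F` is the Ward
identity for `h (1, w, g, g w) (h⁻¹, w h⁻¹ w, h', w h' w) = (1, w, h g h', h g h' w)`, where `MA`
and `w MA w` lie in `Q`.

An element of `G` has a polar decomposition `k exp X` with `X` symmetric in the Lie algebra
(`exists_exp_eq_transpose_mul_self`). On the identity component of the fixed points of the
involution, the path `k exp (s X)` stays in that component, where the diagonal entries at `0` and
`d + 1` are positive; so the orthogonal matrix `k` fixes `e₀` and `e_{d+1}` and centralises `𝔞`.
The matrix `X` is the sum of a multiple of `D₀` and of boost generators in planes orthogonal to `e₀`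
and `e_{d+1}`, and these are commutators in the centraliser of `𝔞` because `p ≥ 2`
(`single_add_single_mem_derivedCentralizer`). Hence this component lies in `MA`
(`mem_MA_of_mem_connectedComponent`).
-/

namespace ConformalWard

/-! ### The form `η` and matrices preserving it -/

lemma gram_mul_self (p q : ℕ) : gram p q * gram p q = 1 := by
  simp only [LieAlgebra.Orthogonal.indefiniteDiagonal, Matrix.diagonal_mul_diagonal]
  rw [← Matrix.diagonal_one]
  congr 1
  ext (i | i) <;> simp

lemma gram_transpose (p q : ℕ) : (gram p q)ᵀ = gram p q := Matrix.diagonal_transpose _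

section

variable {p q : ℕ}

lemma eta_comm (x y : Idx p q → ℝ) : eta p q x y = eta p q y x := by
  rw [eta, eta, Matrix.dotProduct_mulVec, ← Matrix.mulVec_transpose, gram_transpose,
    dotProduct_comm]

lemma eta_add_left (x y z : Idx p q → ℝ) : eta p q (x + y) z = eta p q x z + eta p q y z :=
  add_dotProduct _ _ _

lemma eta_sub_left (x y z : Idx p q → ℝ) : eta p q (x - y) z = eta p q x z - eta p q y z :=
  sub_dotProduct _ _ _

lemma eta_smul_left (a : ℝ) (x z : Idx p q → ℝ) : eta p q (a • x) z = a * eta p q x z :=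
  smul_dotProduct _ _ _

lemma eta_add_right (x y z : Idx p q → ℝ) : eta p q x (y + z) = eta p q x y + eta p q x z := by
  rw [eta_comm, eta_add_left, eta_comm y, eta_comm z]

lemma eta_sub_right (x y z : Idx p q → ℝ) : eta p q x (y - z) = eta p q x y - eta p q x z := by
  rw [eta_comm, eta_sub_left, eta_comm y, eta_comm z]

lemma eta_smul_right (a : ℝ) (x z : Idx p q → ℝ) : eta p q x (a • z) = a * eta p q x z := by
  rw [eta_comm, eta_smul_left, eta_comm]

lemma gram_mulVec_inl (x : Idx p q → ℝ) (i : Fin (p + 1)) :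
    (gram p q *ᵥ x) (Sum.inl i) = x (Sum.inl i) := by
  simp [LieAlgebra.Orthogonal.indefiniteDiagonal, Matrix.mulVec_diagonal]

lemma gram_mulVec_inr (x : Idx p q → ℝ) (i : Fin (q + 1)) :
    (gram p q *ᵥ x) (Sum.inr i) = -x (Sum.inr i) := by
  simp [LieAlgebra.Orthogonal.indefiniteDiagonal, Matrix.mulVec_diagonal]

lemma eta_single_left (i : Idx p q) (a : ℝ) (x : Idx p q → ℝ) :
    eta p q (Pi.single i a) x = a * (gram p q *ᵥ x) i := single_dotProduct _ _ _

lemma eta_mulVec_mulVec (g : Matrix (Idx p q) (Idx p q) ℝ) (x y : Idx p q → ℝ) :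
    eta p q (g *ᵥ x) (g *ᵥ y) = x ⬝ᵥ ((gᵀ * gram p q * g) *ᵥ y) := by
  rw [eta, ← Matrix.mulVec_mulVec, ← Matrix.mulVec_mulVec, ← Matrix.vecMul_transpose,
    ← Matrix.dotProduct_mulVec]

lemma transpose_mul_gram_mul_iff {g : Matrix (Idx p q) (Idx p q) ℝ} :
    gᵀ * gram p q * g = gram p q ↔ ∀ x y, eta p q (g *ᵥ x) (g *ᵥ y) = eta p q x y := by
  refine ⟨fun h x y => by rw [eta_mulVec_mulVec, h, eta], fun h => ?_⟩
  refine Matrix.ext_of_mulVec_single fun j => ?_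
  refine dotProduct_eq _ _ fun x => ?_
  rw [dotProduct_comm, ← eta_mulVec_mulVec, h, eta, dotProduct_comm]

/-! ### Elements of `G` -/

lemma mat_injective : Function.Injective (mat : G p q → _) :=
  fun _ _ h => Subtype.ext (Subtype.ext h)

@[simp] lemma mat_one : mat (1 : G p q) = 1 := rfl

@[simp] lemma mat_mul (g h : G p q) : mat (g * h) = mat g * mat h := rfl

lemma continuous_mat : Continuous (mat : G p q → _) :=
  continuous_subtype_val.comp continuous_subtype_val

lemma continuous_of_mat {X : Type*} [TopologicalSpace X] {f : X → G p q}
    (h : Continuous fun x => mat (f x)) : Continuous f :=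
  Continuous.subtype_mk (f := fun x => (f x).1) (Continuous.subtype_mk h _) _

lemma mat_preserves (g : G p q) : (mat g)ᵀ * gram p q * mat g = gram p q := by
  obtain ⟨h, -, hh⟩ := g.2
  have := h.2
  rw [mat, ← hh]
  exact this

lemma eta_mat_mulVec (g : G p q) (x y : Idx p q → ℝ) :
    eta p q (mat g *ᵥ x) (mat g *ᵥ y) = eta p q x y :=
  transpose_mul_gram_mul_iff.1 (mat_preserves g) x y

/-- A connected family of matrices that preserve `η` and one of which is the identity lies in `G`.
The determinants are `±1` and continuous, so that they need no separate hypothesis. -/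
lemma exists_mat_eq_of_continuous {X : Type*} [TopologicalSpace X] [PreconnectedSpace X]
    {γ : X → Matrix (Idx p q) (Idx p q) ℝ} (hγ : Continuous γ) {x₀ : X} (h0 : γ x₀ = 1)
    (hη : ∀ x, (γ x)ᵀ * gram p q * γ x = gram p q) (x : X) : ∃ g : G p q, mat g = γ x := by
  have hdet : ∀ x, (γ x).det = 1 := by
    have hsq : ∀ x, (γ x).det ^ 2 = 1 := by
      intro x
      have h1 := congrArg Matrix.det (hη x)
      have h2 : (gram p q).det * (gram p q).det = 1 := by
        rw [← Matrix.det_mul, gram_mul_self, Matrix.det_one]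
      rw [Matrix.det_mul, Matrix.det_mul, Matrix.det_transpose] at h1
      linear_combination (gram p q).det * h1 + (1 - (γ x).det ^ 2) * h2
    rcases isPreconnected_univ.eq_one_or_eq_neg_one_of_sq_eq
      (hγ.matrix_det.continuousOn) (fun x _ => by simpa using hsq x) with h | h
    · exact fun x => h (Set.mem_univ x)
    · have := h (Set.mem_univ x₀)
      simp only [h0, Matrix.det_one, Pi.neg_apply, Pi.one_apply] at this
      norm_num at this
  let γ' : X → indefiniteSO p q := fun x => ⟨⟨γ x, hdet x⟩, hη x⟩
  have hγ' : Continuous γ' := Continuous.subtype_mk (Continuous.subtype_mk hγ _) _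
  have h1 : γ' x₀ = 1 := Subtype.ext (Subtype.ext h0)
  have hmem : γ' x ∈ connectedComponent (1 : indefiniteSO p q) :=
    (isPreconnected_range hγ').subset_connectedComponent ⟨x₀, h1⟩ ⟨x, rfl⟩
  exact ⟨⟨(γ' x).1, γ' x, hmem, rfl⟩, rfl⟩

lemma smul_mk_eq (g : G p q) {v : Idx p q → ℝ} (hv : v ≠ 0) (hgv : mat g *ᵥ v ≠ 0) :
    g • Projectivization.mk ℝ v hv = Projectivization.mk ℝ (mat g *ᵥ v) hgv := rfl

lemma mat_mulVec_ne_zero (g : G p q) {v : Idx p q → ℝ} (hv : v ≠ 0) : mat g *ᵥ v ≠ 0 := by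
  intro h
  apply hv
  have := congrArg (fun u => mat g⁻¹ *ᵥ u) h
  simpa [Matrix.mulVec_mulVec, ← mat_mul] using this

lemma mat_inv (g : G p q) : mat g⁻¹ = gram p q * (mat g)ᵀ * gram p q := by
  have h1 : mat g * mat g⁻¹ = 1 := by rw [← mat_mul, mul_inv_cancel, mat_one]
  calc mat g⁻¹ = gram p q * gram p q * mat g⁻¹ := by rw [gram_mul_self, Matrix.one_mul]
    _ = gram p q * ((mat g)ᵀ * gram p q * mat g) * mat g⁻¹ := by rw [mat_preserves]
    _ = gram p q * (mat g)ᵀ * gram p q * (mat g * mat g⁻¹) := by simp only [Matrix.mul_assoc]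
    _ = _ := by rw [h1, Matrix.mul_one]

/-- The diagonal involution `diag(-1, -1, 1, …, 1)` lies in `G` and interchanges the lines of
`ι(0)` and `∞`: it is the end point of a path of rotations in the plane of the
first two positive directions. -/
lemma exists_isDiag_isInversion (hp : 0 < p) :
    ∃ w : G p q, (mat w).IsDiag ∧ IsInversion w := by
  let i1 : Idx p q := Sum.inl ⟨1, by omega⟩
  have h01 : i0 p q ≠ i1 := fun h => by simp [i1, Fin.ext_iff] at h
  let R : ℝ → Matrix (Idx p q) (Idx p q) ℝ := fun t =>
    1 + (Real.cos t - 1) • (Matrix.single (i0 p q) (i0 p q) 1 + Matrix.single i1 i1 1) +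
      Real.sin t • (Matrix.single (i0 p q) i1 1 - Matrix.single i1 (i0 p q) 1)
  have hRv : ∀ t x, R t *ᵥ x = x +
      (Pi.single (i0 p q) ((Real.cos t - 1) * x (i0 p q) + Real.sin t * x i1) +
      Pi.single i1 ((Real.cos t - 1) * x i1 - Real.sin t * x (i0 p q)) : Idx p q → ℝ) := by
    intro t x
    ext j
    simp only [R, Matrix.add_mulVec, Matrix.sub_mulVec, Matrix.smul_mulVec, Matrix.one_mulVec,
      Matrix.single_mulVec, Pi.add_apply, Pi.sub_apply, Pi.smul_apply, smul_eq_mul,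
      Function.update_apply, Pi.single_apply, Pi.zero_apply]
    split_ifs <;> ring
  obtain ⟨w, hw⟩ := exists_mat_eq_of_continuous (p := p) (q := q) (γ := R) (x₀ := 0)
    (by fun_prop) (by simp [R]) (fun t => transpose_mul_gram_mul_iff.2 fun x y => by
      rw [hRv, hRv]
      simp only [eta_add_left, eta_add_right, eta_single_left, eta_comm x (Pi.single _ _),
        gram_mulVec_inl, i1, i0, Pi.single_apply]
      have h01' : (Sum.inl 0 : Idx p q) ≠ i1 := h01
      simp only [i1] at h01'
      simp only [h01', h01'.symm, if_true, if_false]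
      linear_combination (x (Sum.inl 0) * y (Sum.inl 0) +
        x (Sum.inl ⟨1, by omega⟩) * y (Sum.inl ⟨1, by omega⟩)) * Real.sin_sq_add_cos_sq t)
    Real.pi
  have hwd : mat w =
      Matrix.diagonal fun i => if i = i0 p q ∨ i = i1 then (-1 : ℝ) else 1 := by
    rw [hw]
    ext i j
    simp only [R, Real.cos_pi, Real.sin_pi, Matrix.add_apply, Matrix.smul_apply, Matrix.one_apply,
      Matrix.single_apply, Matrix.diagonal_apply, smul_eq_mul, zero_mul, add_zero]
    by_cases hij : i = j
    · subst hij
      by_cases h0 : i = i0 p q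
      · subst h0; simp [h01.symm]
      · by_cases h1 : i = i1
        · subst h1; simp [h01]
        · simp [h0, h1, Ne.symm h0, Ne.symm h1]
    · have h2 : ¬(i0 p q = i ∧ i0 p q = j) := fun h => hij (h.1.symm.trans h.2)
      have h3 : ¬(i1 = i ∧ i1 = j) := fun h => hij (h.1.symm.trans h.2)
      simp [hij, h2, h3]
  have hl1 : iLast p q ≠ i1 := Sum.inr_ne_inl
  have ho : mat w *ᵥ originVec p q = -inftyVec p q := by
    rw [hwd]
    ext j
    simp only [Matrix.mulVec_diagonal, originVec, inftyVec, Pi.add_apply, Pi.neg_apply,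
      Pi.sub_apply, Pi.single_apply]
    by_cases h0 : j = i0 p q
    · subst h0; simp
    · by_cases hl : j = iLast p q
      · subst hl; simp [i1]
      · simp [h0, hl]
  have hi : mat w *ᵥ inftyVec p q = -originVec p q := by
    rw [hwd]
    ext j
    simp only [Matrix.mulVec_diagonal, originVec, inftyVec, Pi.add_apply, Pi.neg_apply,
      Pi.sub_apply, Pi.single_apply]
    by_cases h0 : j = i0 p q
    · subst h0; simp
    · by_cases hl : j = iLast p q
      · subst hl; simp [i1]
      · simp [h0, hl]
  refine ⟨w, hwd ▸ Matrix.isDiag_diagonal _, mat_injective ?_, ?_, ?_⟩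
  · rw [mat_mul, hwd, Matrix.diagonal_mul_diagonal, mat_one, ← Matrix.diagonal_one]
    congr 1
    ext i
    split_ifs <;> norm_num
  · rw [origin, smul_mk_eq w _ (mat_mulVec_ne_zero w (originVec_ne_zero p q)), infty,
      Projectivization.mk_eq_mk_iff']
    exact ⟨-1, by rw [ho, neg_one_smul]⟩
  · rw [infty, smul_mk_eq w _ (mat_mulVec_ne_zero w (inftyVec_ne_zero p q)), origin,
      Projectivization.mk_eq_mk_iff']
    exact ⟨-1, by rw [hi, neg_one_smul]⟩

end

section

variable {p q : ℕ}

/-! ### Transitivity of `G` on pairs of non-orthogonal isotropic lines -/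

/-- The Eichler (or Siegel) transformation
`x ↦ x + η(x, a) u - η(x, u) a - ½ η(u, u) η(x, a) a`. It preserves `η` if `a` is isotropic and
orthogonal to `u`. -/
noncomputable def eichler (a u : Idx p q → ℝ) : Matrix (Idx p q) (Idx p q) ℝ :=
  1 + Matrix.vecMulVec u (gram p q *ᵥ a) - Matrix.vecMulVec a (gram p q *ᵥ u) -
    (1 / 2 * eta p q u u) • Matrix.vecMulVec a (gram p q *ᵥ a)

lemma eichler_mulVec (a u x : Idx p q → ℝ) :
    eichler a u *ᵥ x =
      x + eta p q x a • u - eta p q x u • a - (1 / 2 * eta p q u u * eta p q x a) • a := by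
  simp only [eichler, Matrix.add_mulVec, Matrix.sub_mulVec, Matrix.smul_mulVec,
    Matrix.one_mulVec, Matrix.vecMulVec_mulVec, op_smul_eq_smul, smul_smul, eta,
    dotProduct_comm x]

lemma exists_mat_eq_eichler {a u : Idx p q → ℝ} (ha : eta p q a a = 0) (hau : eta p q a u = 0) :
    ∃ g : G p q, mat g = eichler a u := by
  have hc : Continuous fun t : ℝ => eichler a (t • u) := by
    simp only [eichler, eta_smul_left, eta_smul_right, Matrix.mulVec_smul, Matrix.smul_vecMulVec,
      Matrix.vecMulVec_smul]
    fun_prop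
  obtain ⟨g, hg⟩ := exists_mat_eq_of_continuous hc (x₀ := 0) (by simp [eichler, eta])
    (fun t => transpose_mul_gram_mul_iff.2 fun x y => by
      rw [eichler_mulVec, eichler_mulVec]
      simp only [eta_add_left, eta_sub_left, eta_smul_left, eta_add_right, eta_sub_right,
        eta_smul_right, ha, hau, eta_comm u a, eta_comm a y, eta_comm u y]
      ring) 1
  exact ⟨g, by rw [hg, one_smul]⟩

/-- The stabiliser of an isotropic vector `a` acts transitively on the isotropic lines that are not
orthogonal to `a`. -/
lemma exists_fix_and_map {a x y : Idx p q → ℝ} (ha : eta p q a a = 0) (hx : eta p q x x = 0)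
    (hy : eta p q y y = 0) (hxa : eta p q x a ≠ 0) (hya : eta p q y a ≠ 0) :
    ∃ g : G p q, mat g *ᵥ a = a ∧ ∃ c : ℝ, c ≠ 0 ∧ mat g *ᵥ x = c • y := by
  -- `c` is the factor for which `c y - x` is orthogonal to `a`; the Eichler transformation then
  -- maps `x` to `c y` up to a multiple of `a`, and this multiple vanishes as both are isotropic.
  set s := eta p q x a with hs
  set c := s / eta p q y a with hc
  have hcy : c * eta p q y a = s := div_mul_cancel₀ _ hya
  obtain ⟨g, hg⟩ := exists_mat_eq_eichler (u := s⁻¹ • (c • y - x)) ha (by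
    rw [eta_comm, eta_smul_left, eta_sub_left, eta_smul_left, hcy, ← hs, sub_self, mul_zero])
  refine ⟨g, ?_, c, div_ne_zero hxa hya, ?_⟩
  · rw [hg, eichler_mulVec, ha, eta_smul_right, eta_sub_right, eta_smul_right, eta_comm a y, hcy,
      eta_comm a x, ← hs]
    simp
  · rw [hg, eichler_mulVec]
    simp only [eta_smul_left, eta_sub_left, eta_smul_right, eta_sub_right, ← hs, hx, hy,
      eta_comm y x]
    ext j
    simp only [Pi.add_apply, Pi.sub_apply, Pi.smul_apply, smul_eq_mul]
    field_simp
    ring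

lemma eta_originVec_left (x : Idx p q → ℝ) :
    eta p q (originVec p q) x = x (i0 p q) - x (iLast p q) := by
  rw [originVec, eta_add_left, eta_single_left, eta_single_left, gram_mulVec_inl, gram_mulVec_inr]
  ring

lemma eta_inftyVec_left (x : Idx p q → ℝ) :
    eta p q (inftyVec p q) x = x (i0 p q) + x (iLast p q) := by
  rw [inftyVec, eta_sub_left, eta_single_left, eta_single_left, gram_mulVec_inl, gram_mulVec_inr]
  ring

lemma eta_originVec_self : eta p q (originVec p q) (originVec p q) = 0 := by
  rw [eta_originVec_left]; simp [originVec]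

lemma eta_inftyVec_self : eta p q (inftyVec p q) (inftyVec p q) = 0 := by
  rw [eta_inftyVec_left]; simp [inftyVec]

lemma eta_inftyVec_originVec : eta p q (inftyVec p q) (originVec p q) ≠ 0 := by
  rw [eta_inftyVec_left]; simp [originVec]

lemma eta_self_eq_sum (x : Idx p q → ℝ) :
    eta p q x x = ∑ i, x (Sum.inl i) ^ 2 - ∑ i, x (Sum.inr i) ^ 2 := by
  simp only [eta, dotProduct, Fintype.sum_sum_type, gram_mulVec_inl, gram_mulVec_inr,
    sub_eq_add_neg, ← Finset.sum_neg_distrib]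
  congr 1 <;> exact Finset.sum_congr rfl fun i _ => by ring

/-- Two isotropic lines, one of which is `ι(0)`, have a common non-orthogonal isotropic line: the
vectors `e₀ - e_{d+1}` and `± e_i - e_{d+1}` with `1 ≤ i ≤ p` are not all orthogonal to a given
nonzero isotropic vector. -/
lemma exists_isotropic_not_orthogonal (hp : 0 < p) {x : Idx p q → ℝ} (hx0 : x ≠ 0)
    (hx : eta p q x x = 0) :
    ∃ a : Idx p q → ℝ, eta p q a a = 0 ∧ eta p q (originVec p q) a ≠ 0 ∧ eta p q x a ≠ 0 := by
  by_contra! hcon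
  have h1 : x (i0 p q) + x (iLast p q) = 0 := by
    rw [← eta_inftyVec_left, eta_comm]
    exact hcon _ eta_inftyVec_self (by rw [eta_comm]; exact eta_inftyVec_originVec)
  have h2 : ∀ i : Fin (p + 1), i ≠ 0 → ∀ s : ℝ, s * s = 1 →
      s * x (Sum.inl i) + x (iLast p q) = 0 := by
    intro i hi s hs
    have := hcon (Pi.single (Sum.inl i) s - Pi.single (iLast p q) 1) (by
      simp [eta_sub_left, eta_single_left, gram_mulVec_inl, gram_mulVec_inr, hs]) (by
      rw [eta_originVec_left]
      simp [hi.symm])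
    rw [eta_comm, eta_sub_left, eta_single_left, eta_single_left, gram_mulVec_inl,
      gram_mulVec_inr] at this
    linarith
  have hl : x (iLast p q) = 0 := by
    have hi : (⟨1, by omega⟩ : Fin (p + 1)) ≠ 0 := by simp [Fin.ext_iff]
    have ha := h2 _ hi 1 (by norm_num)
    have hb := h2 _ hi (-1) (by norm_num)
    linarith
  have hpos : ∀ i : Fin (p + 1), x (Sum.inl i) = 0 := by
    intro i
    by_cases hi : i = 0
    · subst hi
      linarith
    · have := h2 i hi 1 (by norm_num)
      linarith
  rw [eta_self_eq_sum] at hx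
  simp only [hpos, ne_eq, OfNat.ofNat_ne_zero, not_false_eq_true, zero_pow, Finset.sum_const_zero,
    zero_sub, neg_eq_zero] at hx
  rw [Finset.sum_eq_zero_iff_of_nonneg fun i _ => sq_nonneg _] at hx
  refine hx0 (funext ?_)
  rintro (i | i)
  · exact hpos i
  · exact pow_eq_zero_iff two_ne_zero |>.1 (hx i (Finset.mem_univ i))

/-- `G` acts transitively on the pairs of non-orthogonal isotropic lines. -/
lemma exists_smul_origin_infty_eq (hp : 0 < p) {x y : ℙ ℝ (Idx p q → ℝ)}
    (hx : eta p q x.rep x.rep = 0) (hy : eta p q y.rep y.rep = 0)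
    (hxy : eta p q x.rep y.rep ≠ 0) :
    ∃ g : G p q, g • origin p q = x ∧ g • infty p q = y := by
  -- First `g` moves `ι(0)` to the first line, then `k` fixes `ι(0)` and corrects the second one.
  obtain ⟨a, ha, hoa, hxa⟩ := exists_isotropic_not_orthogonal hp x.rep_nonzero hx
  obtain ⟨g, -, c, hc, hg⟩ := exists_fix_and_map ha eta_originVec_self hx hoa hxa
  have hcx : mat g⁻¹ *ᵥ x.rep = c⁻¹ • originVec p q := by
    rw [eq_inv_smul_iff₀ hc, ← Matrix.mulVec_smul, ← hg, Matrix.mulVec_mulVec, ← mat_mul,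
      inv_mul_cancel, mat_one, Matrix.one_mulVec]
  obtain ⟨k, hko, d, hd, hk⟩ := exists_fix_and_map (x := inftyVec p q) (y := mat g⁻¹ *ᵥ y.rep)
    eta_originVec_self eta_inftyVec_self (by rwa [eta_mat_mulVec]) eta_inftyVec_originVec (by
      intro h
      apply hxy
      rw [← eta_mat_mulVec g⁻¹, hcx, eta_smul_left, eta_comm, h, mul_zero])
  refine ⟨g * k, ?_, ?_⟩
  · rw [origin, smul_mk_eq _ _ (mat_mulVec_ne_zero _ (originVec_ne_zero p q)), ← x.mk_rep,
      Projectivization.mk_eq_mk_iff']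
    exact ⟨c, by rw [mat_mul, ← Matrix.mulVec_mulVec, hko, hg]⟩
  · rw [infty, smul_mk_eq _ _ (mat_mulVec_ne_zero _ (inftyVec_ne_zero p q)), ← y.mk_rep,
      Projectivization.mk_eq_mk_iff']
    exact ⟨d, by
      rw [mat_mul, ← Matrix.mulVec_mulVec, hk, Matrix.mulVec_smul, Matrix.mulVec_mulVec, ← mat_mul,
        mul_inv_cancel, mat_one, Matrix.one_mulVec]⟩

/-! ### Point configurations under the action of `G` -/

lemma exists_rep_smul (g : G p q) (x : ℙ ℝ (Idx p q → ℝ)) :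
    ∃ c : ℝˣ, (g • x).rep = c • (mat g *ᵥ x.rep) := by
  have h := smul_mk_eq g x.rep_nonzero (mat_mulVec_ne_zero g x.rep_nonzero)
  rw [x.mk_rep] at h
  obtain ⟨c, hc⟩ := Projectivization.exists_smul_eq_mk_rep ℝ _
    (mat_mulVec_ne_zero g x.rep_nonzero)
  exact ⟨c, by rw [h, hc]⟩

lemma GeneralPosition.smul {m : ℕ} {x : Fin m → ℙ ℝ (Idx p q → ℝ)} (hx : GeneralPosition x)
    (g : G p q) : GeneralPosition fun i => g • x i := by
  choose c hc using fun i => exists_rep_smul g (x i)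
  refine ⟨fun i => ?_, ?_, fun i j hij => ?_⟩
  · rw [hc, Units.smul_def, eta_smul_left, eta_smul_right, eta_mat_mulVec, hx.isotropic]
    simp
  · rw [Projectivization.independent_iff]
    have h1 := Projectivization.independent_iff.1 hx.independent
    have hinj : LinearMap.ker (mat g).mulVecLin = ⊥ :=
      LinearMap.ker_eq_bot'.2 fun v hv => by
        by_contra hv0
        exact mat_mulVec_ne_zero g hv0 hv
    have h2 := (h1.map' _ hinj).units_smul c
    have h3 : Projectivization.rep ∘ (fun i => g • x i) =
        c • ⇑(mat g).mulVecLin ∘ Projectivization.rep ∘ x := funext hc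
    rw [h3]
    exact h2
  · rw [hc, hc, Units.smul_def, Units.smul_def, eta_smul_left, eta_smul_right, eta_mat_mulVec]
    exact mul_ne_zero (c i).ne_zero (mul_ne_zero (c j).ne_zero (hx.nonorthogonal i j hij))

lemma mul_mul_mem_Gtilde {h h' g : G p q} (hh : h ∈ MA p q) (hh' : h' ∈ MA p q)
    (hg : g ∈ Gtilde p q) : h * g * h' ∈ Gtilde p q := by
  change GeneralPosition _
  have := GeneralPosition.smul hg h
  convert this using 1
  funext i
  fin_cases i
  · simp [MA_smul_origin hh]
  · simp [MA_smul_infty hh]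
  · simp [mul_smul, MA_smul_origin hh']
  · simp [mul_smul, MA_smul_infty hh']

end

/-! ### Smooth functions -/

section

variable {𝕜 : Type*} [RCLike 𝕜] {S S' E E' : Type*} [NormedAddCommGroup E] [NormedSpace ℝ E]
  [NormedAddCommGroup E'] [NormedSpace ℝ E'] {emb : S → E} {emb' : S' → E'}

lemma IsSmooth.comp {W : Type*} [AddCommGroup W] [Module 𝕜 W] {f : S → W}
    (hf : IsSmooth 𝕜 emb f) {κ : S' → S} {Φ : E' → E} (hΦ : ContDiff ℝ ∞ Φ)
    (hκ : ∀ s, emb (κ s) = Φ (emb' s)) : IsSmooth 𝕜 emb' fun s => f (κ s) := by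
  intro ℓ x
  obtain ⟨N, hN, hx, φ, hφ, h⟩ := hf ℓ (κ x)
  refine ⟨Φ ⁻¹' N, hN.preimage hΦ.continuous, by rw [Set.mem_preimage, ← hκ]; exact hx, φ ∘ Φ,
    hφ.comp hΦ.contDiffOn (Set.mapsTo_preimage Φ N), fun y hy => ?_⟩
  rw [Set.mem_preimage, ← hκ] at hy
  rw [h _ hy, hκ, Function.comp_apply]

/-- A multilinear map is a polynomial in the coordinates of its arguments, hence preserves
smoothness. -/
lemma IsSmooth.multilinear {ι : Type*} [Finite ι] {W : ι → Type*} {Y : Type*}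
    [∀ i, AddCommGroup (W i)] [∀ i, Module 𝕜 (W i)] [∀ i, FiniteDimensional 𝕜 (W i)]
    [AddCommGroup Y] [Module 𝕜 Y] (μ : MultilinearMap 𝕜 W Y) {f : ∀ i, S → W i}
    (hf : ∀ i, IsSmooth 𝕜 emb (f i)) : IsSmooth 𝕜 emb fun s => μ fun i => f i s := by
  classical
  have := Fintype.ofFinite ι
  intro ℓ x
  let b := fun i => Module.finBasis 𝕜 (W i)
  choose N hN hx φ hφ h using fun i j => hf i ((b i).coord j) x
  refine ⟨⋂ i, ⋂ j, N i j, isOpen_iInter_of_finite fun i => isOpen_iInter_of_finite fun j => hN i j,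
    Set.mem_iInter₂.2 hx,
    fun e => ∑ r : ∀ i, Fin (Module.finrank 𝕜 (W i)),
      (∏ i, φ i (r i) e) * ℓ (μ fun i => b i (r i)), ?_, fun y hy => ?_⟩
  · refine ContDiffOn.sum fun r _ => ContDiffOn.mul (contDiffOn_prod fun i _ => ?_) contDiffOn_const
    exact (hφ i (r i)).mono ((Set.iInter_subset _ i).trans (Set.iInter_subset _ (r i)))
  · have hfy : (fun i => f i y) = fun i => ∑ j, φ i j (emb y) • b i j := by
      funext i
      rw [← (b i).sum_repr (f i y)]
      refine Finset.sum_congr rfl fun j _ => ?_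
      rw [← h i j y (Set.mem_iInter₂.1 hy i j)]
      simp
    beta_reduce
    rw [hfy, MultilinearMap.map_sum, map_sum]
    refine Finset.sum_congr rfl fun r _ => ?_
    rw [MultilinearMap.map_smul_univ, map_smul, smul_eq_mul]

end

section

variable {p q : ℕ}

lemma contDiff_mul_mul (a b : Matrix (Idx p q) (Idx p q) ℝ) :
    ContDiff ℝ ∞ fun (e : Idx p q → Idx p q → ℝ) i j => (a * Matrix.of e * b) i j := by
  refine contDiff_pi.2 fun i => contDiff_pi.2 fun j => ?_
  simp only [Matrix.mul_apply, Matrix.of_apply]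
  fun_prop

lemma contDiff_mul_transpose_mul (a b : Matrix (Idx p q) (Idx p q) ℝ) :
    ContDiff ℝ ∞ fun (e : Idx p q → Idx p q → ℝ) i j => (a * (Matrix.of e)ᵀ * b) i j := by
  refine contDiff_pi.2 fun i => contDiff_pi.2 fun j => ?_
  simp only [Matrix.mul_apply, Matrix.transpose_apply, Matrix.of_apply]
  fun_prop

variable {𝕜 : Type*} [RCLike 𝕜] {V : Fin 4 → Type*}
  [∀ i, AddCommGroup (V i)] [∀ i, Module 𝕜 (V i)] {π : ∀ i, Representation 𝕜 (Q p q) (V i)}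
  {w : G p q}

/-- If the components of a map into `Q⁴` are obtained from smooth maps of the matrix entries, then
the tensor representation of smooth representations is smooth along this map. -/
lemma isSmooth_tensorRep [∀ i, FiniteDimensional 𝕜 (V i)] {S E : Type*} [NormedAddCommGroup E]
    [NormedSpace ℝ E] {emb : S → E}
    (hπ : ∀ i, IsSmooth 𝕜 (fun k : Q p q => entries k.1) (π i)) {κ : S → Fin 4 → Q p q}
    {Φ : Fin 4 → E → Idx p q → Idx p q → ℝ} (hΦ : ∀ i, ContDiff ℝ ∞ (Φ i))
    (hκ : ∀ i s, entries (κ s i).1 = Φ i (emb s)) :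
    IsSmooth 𝕜 emb fun s => tensorRep π (κ s) :=
  IsSmooth.multilinear (PiTensorProduct.mapMultilinear 𝕜 V V)
    (f := fun i s => π i (κ s i)) fun i => (hπ i).comp (hΦ i) (hκ i)

lemma leftAction_apply (hw : IsInversion w) (h : MA p q) :
    leftAction π hw h = tensorRep π ![inclMA p q h, conjMA hw h, 1, 1] := by
  rw [leftAction, MonoidHom.comp_apply]
  congr 1
  funext i
  fin_cases i <;> rfl

lemma rightAction_apply (hw : IsInversion w) (h : MA p q) :
    rightAction π hw (MulOpposite.op h) =
      tensorRep π ![1, 1, inclMA p q h⁻¹, conjMA hw h⁻¹] := by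
  rw [rightAction, MonoidHom.comp_apply, MonoidHom.comp_apply]
  congr 1
  funext i
  fin_cases i <;> rfl

lemma isSmooth_leftAction [∀ i, FiniteDimensional 𝕜 (V i)] (hw : IsInversion w)
    (hπ : ∀ i, IsSmooth 𝕜 (fun k : Q p q => entries k.1) (π i)) :
    IsSmooth 𝕜 (fun h : MA p q => entries h.1) (leftAction π hw) := by
  have := isSmooth_tensorRep (emb := fun h : MA p q => entries h.1)
    (κ := fun h => ![inclMA p q h, conjMA hw h, 1, 1]) hπ
    (Φ := ![id, fun e i j => (mat w * Matrix.of e * mat w) i j,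
      fun _ => entries 1, fun _ => entries 1])
    (fun i => by
      fin_cases i
      · exact contDiff_id
      · exact contDiff_mul_mul _ _
      · exact contDiff_const
      · exact contDiff_const)
    (fun i s => by fin_cases i <;> rfl)
  rwa [← show _ = _ from funext (leftAction_apply (π := π) hw)] at this

lemma isSmooth_rightAction [∀ i, FiniteDimensional 𝕜 (V i)] (hw : IsInversion w)
    (hπ : ∀ i, IsSmooth 𝕜 (fun k : Q p q => entries k.1) (π i)) :
    IsSmooth 𝕜 (fun h : MA p q => entries h.1)
      fun h => rightAction π hw (MulOpposite.op h) := by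
  have := isSmooth_tensorRep (emb := fun h : MA p q => entries h.1)
    (κ := fun h => ![1, 1, inclMA p q h⁻¹, conjMA hw h⁻¹]) hπ
    -- The entries of `h⁻¹` depend linearly on those of `h`, see `mat_inv`.
    (Φ := ![fun _ => entries 1, fun _ => entries 1,
      fun e i j => (gram p q * (Matrix.of e)ᵀ * gram p q) i j,
      fun e i j => ((mat w * gram p q) * (Matrix.of e)ᵀ * (gram p q * mat w)) i j])
    (fun i => by
      fin_cases i
      · exact contDiff_const
      · exact contDiff_const
      · exact contDiff_mul_transpose_mul _ _
      · exact contDiff_mul_transpose_mul _ _)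
    (fun i s => by
      fin_cases i
      · rfl
      · rfl
      · funext a b
        exact congrFun (congrFun (mat_inv s.1) a) b
      · funext a b
        refine congrFun (congrFun (?_ : mat w * mat (s.1⁻¹) * mat w =
          (mat w * gram p q) * (mat s.1)ᵀ * (gram p q * mat w)) a) b
        rw [mat_inv]
        simp only [Matrix.mul_assoc])
  rwa [← show _ = _ from funext (rightAction_apply (π := π) hw)] at this

/-! ### The matrix-spherical function of a solution of the Ward identities -/

lemma IsInversion.inv_eq (hw : IsInversion w) : w⁻¹ = w := inv_eq_of_mul_eq_one_left hw.mul_self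

lemma leftAction_rightAction (hw : IsInversion w) (h h' : MA p q) (v : ⨂[𝕜] i, V i) :
    leftAction π hw h (rightAction π hw (MulOpposite.op h') v) =
      tensorRep π ![inclMA p q h, conjMA hw h, inclMA p q h'⁻¹, conjMA hw h'⁻¹] v := by
  rw [leftAction_apply, rightAction_apply, ← Module.End.mul_apply, ← map_mul]
  congr 2
  funext i
  fin_cases i <;> simp

lemma rightAction_leftAction (hw : IsInversion w) (h h' : MA p q) (v : ⨂[𝕜] i, V i) :
    rightAction π hw (MulOpposite.op h') (leftAction π hw h v) =
      tensorRep π ![inclMA p q h, conjMA hw h, inclMA p q h'⁻¹, conjMA hw h'⁻¹] v := by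
  rw [leftAction_apply, rightAction_apply, ← Module.End.mul_apply, ← map_mul]
  congr 2
  funext i
  fin_cases i <;> simp

lemma isMatrixSpherical_toSpherical (hw : IsInversion w) {f : U p q → ⨂[𝕜] i, V i}
    (hf : SatisfiesWard π f) :
    IsMatrixSpherical (MA p q) (leftAction π hw) (rightAction π hw) (Gtilde p q)
      (toSpherical hw f) where
  bimodule h h' v := by rw [leftAction_rightAction, rightAction_leftAction]
  invariant h h' g hg := mul_mul_mem_Gtilde h.2 h'.2 hg
  smooth := by
    refine hf.smooth.comp
      (κ := fun g : Gtilde p q => ⟨![1, w, g, g * w], mem_U_of_mem_Gtilde hw g.2⟩)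
      (Φ := fun e => ![entries 1, entries w, e,
        fun i j => ((1 : Matrix (Idx p q) (Idx p q) ℝ) * Matrix.of e * mat w) i j])
      (contDiff_pi.2 fun i => ?_) fun g => funext fun i => ?_
    · fin_cases i
      · exact contDiff_const
      · exact contDiff_const
      · exact contDiff_id
      · exact contDiff_mul_mul _ _
    · fin_cases i
      · rfl
      · rfl
      · rfl
      · funext a b
        refine congrFun (congrFun (?_ : mat g.1 * mat w = 1 * mat g.1 * mat w) a) b
        rw [Matrix.one_mul]
  equivariant h h' g hg := by
    rw [leftAction_rightAction]
    have := hf.equivariant h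
      (![inclMA p q h, conjMA hw h, inclMA p q h'⁻¹, conjMA hw h'⁻¹])⁻¹
      ⟨![1, w, g, g * w], mem_U_of_mem_Gtilde hw hg⟩
      ⟨![1, w, h * g * h', h * g * h' * w],
        mem_U_of_mem_Gtilde hw (mul_mul_mem_Gtilde h.2 h'.2 hg)⟩ (fun i => by
      have hi : ∀ a : MA p q, ((conjMA hw a : Q p q) : G p q) = w * a * w := fun _ => rfl
      have hi' : ∀ a : MA p q, ((inclMA p q a : Q p q) : G p q) = a := fun _ => rfl
      have hww : ∀ a : G p q, w * (w * a) = a := fun a => by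
        rw [← mul_assoc, hw.mul_self, one_mul]
      fin_cases i <;> simp [hi, hi', mul_assoc, hw.inv_eq, hww])
    rw [inv_inv] at this
    exact this

/-- Every element of `U` is equivalent under `G × Q⁴` to a quadruple `(1, w, g, g w)`, because `G`
acts transitively on pairs of non-orthogonal isotropic lines. -/
lemma exists_eq_mul_mul (hp : 0 < p) (hw : IsInversion w) (x : U p q) :
    ∃ (a : G p q) (g : G p q) (_ : g ∈ Gtilde p q) (k : Fin 4 → Q p q),
      ∀ i, x.1 i = a * (![1, w, g, g * w] : Fin 4 → G p q) i * (k i : G p q) := by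
  have hx : GeneralPosition fun i => x.1 i • origin p q := x.2
  obtain ⟨a, ha0, ha1⟩ := exists_smul_origin_infty_eq hp (hx.isotropic 0) (hx.isotropic 1)
    (hx.nonorthogonal 0 1 (by decide))
  obtain ⟨b, hb0, hb1⟩ := exists_smul_origin_infty_eq hp (hx.isotropic 2) (hx.isotropic 3)
    (hx.nonorthogonal 2 3 (by decide))
  have hz : ∀ i, (a * (![1, w, a⁻¹ * b, a⁻¹ * b * w] : Fin 4 → G p q) i) • origin p q =
      x.1 i • origin p q := by
    intro i
    fin_cases i
    · simpa using ha0
    · simpa [mul_smul, hw.smul_origin] using ha1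
    · simpa using hb0
    · simpa [mul_smul, hw.smul_origin] using hb1
  refine ⟨a, a⁻¹ * b, ?_,
    fun i => ⟨(a * (![1, w, a⁻¹ * b, a⁻¹ * b * w] : Fin 4 → G p q) i)⁻¹ * x.1 i, ?_⟩, fun i => ?_⟩
  · change GeneralPosition _
    convert GeneralPosition.smul hx a⁻¹ using 1
    funext i
    rw [← hz i, smul_smul a⁻¹, inv_mul_cancel_left]
    fin_cases i
    · simp
    · simp [hw.smul_origin]
    · simp
    · simp [mul_smul, hw.smul_origin]
  · change (_ * x.1 i) • origin p q = origin p q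
    rw [mul_smul, ← hz i, inv_smul_smul]
  · rw [mul_inv_cancel_left]

lemma injOn_toSpherical (hp : 0 < p) (hw : IsInversion w) :
    Set.InjOn (toSpherical (W := ⨂[𝕜] i, V i) hw) {f | SatisfiesWard π f} := by
  intro f hf f' hf' hff'
  funext x
  obtain ⟨a, g, hg, k, hx⟩ := exists_eq_mul_mul hp hw x
  rw [hf.equivariant a k ⟨_, mem_U_of_mem_Gtilde hw hg⟩ x hx,
    hf'.equivariant a k ⟨_, mem_U_of_mem_Gtilde hw hg⟩ x hx]
  exact congrArg _ (congrFun hff' ⟨g, hg⟩)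

end

/-! ### Logarithms of symmetric positive definite matrices -/

section

open scoped Matrix.Norms.L2Operator MatrixOrder

variable {n : Type*} [Fintype n] [DecidableEq n]

lemma exists_exp_eq_of_posDef {P : Matrix n n ℝ} (hP : P.PosDef) :
    ∃ Y : Matrix n n ℝ, Yᵀ = Y ∧ NormedSpace.exp Y = P ∧
      ∀ R : Matrix n n ℝ, Commute P R → Commute Y R := by
  refine ⟨CFC.log P, ?_, CFC.exp_log P hP.isStrictlyPositive, fun R hR => ?_⟩
  · have : IsSelfAdjoint (CFC.log P) := IsSelfAdjoint.log
    rw [← Matrix.conjTranspose_eq_transpose_of_trivial]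
    exact this
  · exact IsSelfAdjoint.commute_cfc hP.1 hR _

lemma exp_injOn_symmetric {X Y : Matrix n n ℝ} (hX : Xᵀ = X) (hY : Yᵀ = Y)
    (h : NormedSpace.exp X = NormedSpace.exp Y) : X = Y := by
  have h1 := CFC.log_exp X (by
    rw [isSelfAdjoint_iff, Matrix.star_eq_conjTranspose,
      Matrix.conjTranspose_eq_transpose_of_trivial, hX])
  have h2 := CFC.log_exp Y (by
    rw [isSelfAdjoint_iff, Matrix.star_eq_conjTranspose,
      Matrix.conjTranspose_eq_transpose_of_trivial, hY])
  rw [← h1, ← h2]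
  exact congrArg _ h

end

section

variable {n : Type*} [Fintype n] [DecidableEq n]

lemma posDef_transpose_mul_self {x : Matrix n n ℝ} (hx : IsUnit x) : (xᵀ * x).PosDef := by
  rw [← Matrix.conjTranspose_eq_transpose_of_trivial]
  exact Matrix.PosDef.conjTranspose_mul_self _ (Matrix.mulVec_injective_of_isUnit hx)

end

section

open scoped Matrix.Norms.L2Operator

lemma continuous_exp_smul {n : Type*} [Fintype n] [DecidableEq n] (X : Matrix n n ℝ) :
    Continuous fun t : ℝ => NormedSpace.exp (t • X) := by
  let +nondep : NormedAlgebra ℚ (Matrix n n ℝ) := .restrictScalars ℚ ℝ _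
  exact NormedSpace.exp_continuous.comp (continuous_id.smul continuous_const)

end

section

variable {p q : ℕ}

/-! ### Cartan decomposition -/

lemma exp_gram_conj (X : Matrix (Idx p q) (Idx p q) ℝ) :
    NormedSpace.exp (gram p q * X * gram p q) = gram p q * NormedSpace.exp X * gram p q := by
  have hinv : (gram p q)⁻¹ = gram p q := Matrix.inv_eq_right_inv (gram_mul_self p q)
  have := Matrix.exp_conj (gram p q) X (IsUnit.of_mul_eq_one _ (gram_mul_self p q))
  rwa [hinv] at this

lemma exp_mul_exp_neg (X : Matrix (Idx p q) (Idx p q) ℝ) :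
    NormedSpace.exp X * NormedSpace.exp (-X) = 1 := by
  rw [← Matrix.exp_add_of_commute _ _ (Commute.neg_right (Commute.refl X)), add_neg_cancel,
    NormedSpace.exp_zero]

lemma exists_mat_eq_exp {X : Matrix (Idx p q) (Idx p q) ℝ} (hX : Xᵀ = X)
    (hXJ : gram p q * X * gram p q = -X) (t : ℝ) :
    ∃ g : G p q, mat g = NormedSpace.exp (t • X) := by
  refine exists_mat_eq_of_continuous (continuous_exp_smul X) (x₀ := 0) (by simp) (fun t => ?_) t
  rw [← Matrix.exp_transpose, Matrix.transpose_smul, hX]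
  have h1 : gram p q * NormedSpace.exp (t • X) = NormedSpace.exp (-(t • X)) * gram p q := by
    rw [← smul_neg, ← hXJ, ← Matrix.smul_mul, ← Matrix.mul_smul, exp_gram_conj, Matrix.mul_assoc,
      gram_mul_self, Matrix.mul_one]
  rw [Matrix.mul_assoc, h1, ← Matrix.mul_assoc, exp_mul_exp_neg, Matrix.one_mul]

/-- The symmetric factor of the polar decomposition of `g` is `exp X` with `X` in the Lie algebra:
conjugation with the Gram matrix inverts `gᵀ g`, hence negates its symmetric logarithm, which is
unique. -/
lemma exists_exp_eq_transpose_mul_self (g : G p q) :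
    ∃ X : Matrix (Idx p q) (Idx p q) ℝ, Xᵀ = X ∧ gram p q * X * gram p q = -X ∧
      NormedSpace.exp (X + X) = (mat g)ᵀ * mat g ∧
      ∀ R, Commute ((mat g)ᵀ * mat g) R → Commute X R := by
  have h1 : mat g * mat g⁻¹ = 1 := by rw [← mat_mul, mul_inv_cancel, mat_one]
  have h2 : mat g⁻¹ * mat g = 1 := by rw [← mat_mul, inv_mul_cancel, mat_one]
  obtain ⟨Y, hY, hexp, hcomm⟩ := exists_exp_eq_of_posDef
    (posDef_transpose_mul_self (IsUnit.of_mul_eq_one _ h1 : IsUnit (mat g)))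
  have hYY : (1 / 2 : ℝ) • Y + (1 / 2 : ℝ) • Y = Y := by rw [← add_smul]; norm_num
  have hJY : gram p q * -Y * gram p q = Y := by
    refine exp_injOn_symmetric ?_ hY ?_
    · rw [Matrix.transpose_mul, Matrix.transpose_mul, gram_transpose, Matrix.transpose_neg, hY,
        Matrix.mul_assoc]
    · have h3 : NormedSpace.exp (-Y) = gram p q * ((mat g)ᵀ * mat g) * gram p q := by
        calc NormedSpace.exp (-Y) = mat g⁻¹ * (mat g⁻¹)ᵀ * ((mat g)ᵀ * mat g) *
              NormedSpace.exp (-Y) := by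
              rw [Matrix.mul_assoc (mat g⁻¹), ← Matrix.mul_assoc (mat g⁻¹)ᵀ,
                ← Matrix.transpose_mul, h1, Matrix.transpose_one, Matrix.one_mul, h2,
                Matrix.one_mul]
          _ = mat g⁻¹ * (mat g⁻¹)ᵀ := by
              rw [← hexp, Matrix.mul_assoc, exp_mul_exp_neg, Matrix.mul_one]
          _ = gram p q * (mat g)ᵀ * (gram p q * gram p q) * mat g * gram p q := by
              rw [mat_inv, Matrix.transpose_mul, Matrix.transpose_mul, gram_transpose,
                Matrix.transpose_transpose]
              simp only [Matrix.mul_assoc]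
          _ = _ := by rw [gram_mul_self, Matrix.mul_one]; simp only [Matrix.mul_assoc]
      rw [exp_gram_conj, h3, hexp]
      calc _ = (gram p q * gram p q) * ((mat g)ᵀ * mat g) * (gram p q * gram p q) := by
            simp only [Matrix.mul_assoc]
        _ = _ := by rw [gram_mul_self, Matrix.one_mul, Matrix.mul_one]
  refine ⟨(1 / 2 : ℝ) • Y, by rw [Matrix.transpose_smul, hY], ?_, by rw [hYY, hexp],
    fun R hR => (hcomm R hR).smul_left _⟩
  rw [Matrix.mul_neg, Matrix.neg_mul, neg_eq_iff_eq_neg] at hJY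
  rw [Matrix.mul_smul, Matrix.smul_mul, hJY, smul_neg]

/-! ### The symmetric part of the centraliser of `𝔞` -/

lemma apply_eq_zero_of_commute_diagonal {n : Type*} [Fintype n] [DecidableEq n]
    {d : n → ℝ} {k : Matrix n n ℝ} (h : Commute k (Matrix.diagonal d)) {i j : n}
    (hij : d i ≠ d j) : k i j = 0 := by
  have := congrFun (congrFun h.eq i) j
  rw [Matrix.mul_diagonal, Matrix.diagonal_mul] at this
  have h2 : (d i - d j) * k i j = 0 := by linarith
  exact (mul_eq_zero.1 h2).resolve_left (sub_ne_zero.2 hij)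

lemma single_add_single_mem_lieG (a : Fin (p + 1)) (b : Fin (q + 1)) :
    (Matrix.single (Sum.inl a) (Sum.inr b) 1 + Matrix.single (Sum.inr b) (Sum.inl a) 1 :
      Matrix (Idx p q) (Idx p q) ℝ) ∈ lieG p q := by
  rw [mem_skewAdjointMatricesSubmodule, Matrix.IsSkewAdjoint, Matrix.IsAdjointPair]
  ext (i | i) (j | j)
  · simp [LieAlgebra.Orthogonal.indefiniteDiagonal]
  · simp [LieAlgebra.Orthogonal.indefiniteDiagonal, Matrix.single_apply]
  · simp only [LieAlgebra.Orthogonal.indefiniteDiagonal, Matrix.mul_diagonal, Matrix.diagonal_mul,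
      Matrix.transpose_apply, Matrix.add_apply, Matrix.neg_apply, Matrix.single_apply, Sum.elim_inl,
      Sum.elim_inr, reduceCtorEq, false_and, Sum.inl.injEq, Sum.inr.injEq, if_false]
    simp only [and_comm]
    ring
  · simp [LieAlgebra.Orthogonal.indefiniteDiagonal]

lemma single_sub_single_mem_lieG (a b : Fin (p + 1)) :
    (Matrix.single (Sum.inl a) (Sum.inl b) 1 - Matrix.single (Sum.inl b) (Sum.inl a) 1 :
      Matrix (Idx p q) (Idx p q) ℝ) ∈ lieG p q := by
  rw [mem_skewAdjointMatricesSubmodule, Matrix.IsSkewAdjoint, Matrix.IsAdjointPair]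
  ext (i | i) (j | j) <;>
  simp [LieAlgebra.Orthogonal.indefiniteDiagonal, Matrix.mul_diagonal, Matrix.diagonal_mul,
    Matrix.single_apply, and_comm]

lemma commute_single_D0 {i j : Idx p q} (hi0 : i ≠ i0 p q) (hil : i ≠ iLast p q)
    (hj0 : j ≠ i0 p q) (hjl : j ≠ iLast p q) (c : ℝ) :
    Commute (Matrix.single i j c) (D0 p q) := by
  rw [Commute, SemiconjBy, D0, Matrix.mul_add, Matrix.add_mul,
    Matrix.single_mul_single_of_ne _ _ _ _ hj0, Matrix.single_mul_single_of_ne _ _ _ _ hjl,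
    Matrix.single_mul_single_of_ne _ _ _ _ hi0.symm,
    Matrix.single_mul_single_of_ne _ _ _ _ hil.symm]

/-- The boost generator `E_{ab} + E_{ba}` is the commutator of a rotation generator in the plane
`(a, c)` with the boost generator in the plane `(c, b)`; the third positive direction `c` is
available as `p ≥ 2`. -/
lemma single_add_single_mem_derivedCentralizer (hp : 2 ≤ p) {a : Fin (p + 1)} {b : Fin (q + 1)}
    (ha : a ≠ 0) (hb : b ≠ Fin.last q) :
    (Matrix.single (Sum.inl a) (Sum.inr b) 1 + Matrix.single (Sum.inr b) (Sum.inl a) 1 :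
      Matrix (Idx p q) (Idx p q) ℝ) ∈ derivedCentralizer p q := by
  obtain ⟨c, hc0, hca⟩ : ∃ c : Fin (p + 1), c ≠ 0 ∧ c ≠ a := by
    by_cases h : a = ⟨1, by omega⟩
    · exact ⟨⟨2, by omega⟩, by simp [Fin.ext_iff], by simp [h, Fin.ext_iff]⟩
    · exact ⟨⟨1, by omega⟩, by simp [Fin.ext_iff], Ne.symm h⟩
  have hinl : ∀ {i : Fin (p + 1)}, i ≠ 0 → (Sum.inl i : Idx p q) ≠ i0 p q :=
    fun h => Sum.inl_injective.ne h
  have hinl' : ∀ i : Fin (p + 1), (Sum.inl i : Idx p q) ≠ iLast p q := fun _ => Sum.inl_ne_inr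
  have hinr : (Sum.inr b : Idx p q) ≠ i0 p q := Sum.inr_ne_inl
  have hinr' : (Sum.inr b : Idx p q) ≠ iLast p q := Sum.inr_injective.ne hb
  refine Submodule.subset_span ⟨_, single_sub_single_mem_lieG a c, _,
    single_add_single_mem_lieG c b, ?_, ?_, ?_⟩
  · exact (commute_single_D0 (hinl ha) (hinl' _) (hinl hc0) (hinl' _) 1).sub_left
      (commute_single_D0 (hinl hc0) (hinl' _) (hinl ha) (hinl' _) 1)
  · exact (commute_single_D0 (hinl hc0) (hinl' _) hinr hinr' 1).add_left
      (commute_single_D0 hinr hinr' (hinl hc0) (hinl' _) 1)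
  · have h1 : (Sum.inl c : Idx p q) ≠ Sum.inl a := Sum.inl_injective.ne hca
    simp [Matrix.sub_mul, Matrix.mul_sub, Matrix.add_mul, Matrix.mul_add,
      Matrix.single_mul_single_of_ne, h1, h1.symm]

/-- The eigenvalues of `reflMatrix` on the hyperbolic plane of `e₀` and `e_{d+1}` differ from those
on its orthogonal complement. -/
lemma reflMatrix_apply_ne {i : Idx p q} (h0 : i ≠ i0 p q) (hl : i ≠ iLast p q) (j : Idx p q)
    (hj : j = i0 p q ∨ j = iLast p q) :
    (if i = i0 p q ∨ i = iLast p q then (-1 : ℝ) else 1) ≠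
      if j = i0 p q ∨ j = iLast p q then -1 else 1 := by
  rw [if_pos hj, if_neg (by simp [h0, hl])]
  norm_num

/-- A symmetric element of `𝔤` fixed by the involution is, up to a multiple of `D₀`, a combination
of boost generators in planes orthogonal to `e₀` and `e_{d+1}`. -/
lemma sub_smul_D0_mem_derivedCentralizer (hp : 2 ≤ p) {X : Matrix (Idx p q) (Idx p q) ℝ}
    (hX : Xᵀ = X) (hXJ : gram p q * X * gram p q = -X) (hXR : Commute X (reflMatrix p q)) :
    X - X (i0 p q) (iLast p q) • D0 p q ∈ derivedCentralizer p q := by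
  have hsym : ∀ i j, X i j = X j i := fun i j => by
    conv_lhs => rw [← hX, Matrix.transpose_apply]
  have hll : ∀ a a' : Fin (p + 1), X (Sum.inl a) (Sum.inl a') = 0 := by
    intro a a'
    have := congrFun (congrFun hXJ (Sum.inl a)) (Sum.inl a')
    simp [LieAlgebra.Orthogonal.indefiniteDiagonal, Matrix.mul_diagonal, Matrix.diagonal_mul]
      at this
    linarith
  have hrr : ∀ b b' : Fin (q + 1), X (Sum.inr b) (Sum.inr b') = 0 := by
    intro a a'
    have := congrFun (congrFun hXJ (Sum.inr a)) (Sum.inr a')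
    simp [LieAlgebra.Orthogonal.indefiniteDiagonal, Matrix.mul_diagonal, Matrix.diagonal_mul]
      at this
    linarith
  set Y := X - X (i0 p q) (iLast p q) • D0 p q with hY
  have hYsum : Y = ∑ a : Fin (p + 1), ∑ b : Fin (q + 1), Y (Sum.inl a) (Sum.inr b) •
      (Matrix.single (Sum.inl a) (Sum.inr b) 1 + Matrix.single (Sum.inr b) (Sum.inl a) 1) := by
    ext (i | i) (j | j)
    · simp [Matrix.sum_apply, Matrix.single_apply, hY, hll, D0]
    · simp [Matrix.sum_apply, Matrix.single_apply, ite_and]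
    · have : Y (Sum.inr i) (Sum.inl j) = Y (Sum.inl j) (Sum.inr i) := by
        simp [hY, hsym (Sum.inr i), D0, Matrix.single_apply, and_comm]
      simp [Matrix.sum_apply, Matrix.single_apply, ite_and, this]
    · simp [Matrix.sum_apply, Matrix.single_apply, hY, hrr, D0]
  rw [hYsum]
  refine Submodule.sum_mem _ fun a _ => Submodule.sum_mem _ fun b _ => ?_
  by_cases ha : a = 0
  · by_cases hb : b = Fin.last q
    · have : Y (Sum.inl a) (Sum.inr b) = 0 := by simp [hY, ha, hb, D0]
      rw [this, zero_smul]
      exact zero_mem _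
    · have h1 : X (Sum.inl a) (Sum.inr b) = 0 := by
        refine apply_eq_zero_of_commute_diagonal hXR (Ne.symm ?_)
        exact reflMatrix_apply_ne Sum.inr_ne_inl (Sum.inr_injective.ne hb) _ (Or.inl (by rw [ha]))
      have : Y (Sum.inl a) (Sum.inr b) = 0 := by simp [hY, h1, D0, Ne.symm hb]
      rw [this, zero_smul]
      exact zero_mem _
  · by_cases hb : b = Fin.last q
    · have h1 : X (Sum.inl a) (Sum.inr b) = 0 := by
        refine apply_eq_zero_of_commute_diagonal hXR ?_
        exact reflMatrix_apply_ne (Sum.inl_injective.ne ha) Sum.inl_ne_inr _ (Or.inr (by rw [hb]))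
      have : Y (Sum.inl a) (Sum.inr b) = 0 := by simp [hY, h1, D0, Ne.symm ha]
      rw [this, zero_smul]
      exact zero_mem _
    · exact Submodule.smul_mem _ _ (single_add_single_mem_derivedCentralizer hp ha hb)

lemma D0_transpose : (D0 p q)ᵀ = D0 p q := by
  simp [D0, Matrix.transpose_add, Matrix.transpose_single, add_comm]

lemma gram_mul_D0_mul_gram : gram p q * D0 p q * gram p q = -D0 p q := by
  ext (i | i) (j | j) <;>
  simp [LieAlgebra.Orthogonal.indefiniteDiagonal, Matrix.mul_diagonal, Matrix.diagonal_mul, D0]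

lemma reflMatrix_eq : reflMatrix p q = 1 - (2 : ℝ) • (D0 p q * D0 p q) := by
  have h1 : D0 p q * D0 p q =
      Matrix.single (i0 p q) (i0 p q) 1 + Matrix.single (iLast p q) (iLast p q) 1 := by
    simp [D0, Matrix.mul_add, Matrix.add_mul, Matrix.single_mul_single_of_ne, add_comm]
  rw [h1, reflMatrix]
  ext (i | i) (j | j)
  · by_cases h : i = j
    · subst h
      by_cases h0 : i = 0
      · simp [h0]; norm_num
      · simp [h0, Ne.symm h0]
    · have : ¬(0 = i ∧ 0 = j) := fun h' => h (h'.1.symm.trans h'.2)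
      simp [h, this]
  · simp
  · simp
  · by_cases h : i = j
    · subst h
      by_cases h0 : i = Fin.last q
      · simp [h0]; norm_num
      · simp [h0, Ne.symm h0]
    · have : ¬(Fin.last q = i ∧ Fin.last q = j) := fun h' => h (h'.1.symm.trans h'.2)
      simp [h, this]

lemma reflMatrix_mul_self : reflMatrix p q * reflMatrix p q = 1 := by
  rw [reflMatrix, Matrix.diagonal_mul_diagonal, ← Matrix.diagonal_one]
  congr 1
  ext i
  split_ifs <;> norm_num

lemma commute_gram_reflMatrix : Commute (gram p q) (reflMatrix p q) := by
  rw [reflMatrix]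
  exact Matrix.commute_diagonal _ _

end

section

variable {p q : ℕ}

/-! ### The symmetric pair `(G, MA)` -/

/-- Conjugation with `diag(-1, 1, …, 1, -1)` maps the identity component of `SO(p+1, q+1)` to
itself, as it is continuous and fixes the identity. -/
lemma exists_mat_eq_reflMatrix_conj (g : G p q) :
    ∃ h : G p q, mat h = reflMatrix p q * mat g * reflMatrix p q := by
  have hR : (reflMatrix p q)ᵀ = reflMatrix p q := Matrix.diagonal_transpose _
  have hdet : (reflMatrix p q).det * (reflMatrix p q).det = 1 := by
    rw [← Matrix.det_mul, reflMatrix_mul_self, Matrix.det_one]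
  have hpres : ∀ x : Matrix (Idx p q) (Idx p q) ℝ, xᵀ * gram p q * x = gram p q →
      (reflMatrix p q * x * reflMatrix p q)ᵀ * gram p q * (reflMatrix p q * x * reflMatrix p q) =
        gram p q := by
    intro x hx
    have hJ := (commute_gram_reflMatrix (p := p) (q := q)).eq
    calc _ = reflMatrix p q * xᵀ * (reflMatrix p q * gram p q * reflMatrix p q) * x *
          reflMatrix p q := by
          simp only [Matrix.transpose_mul, hR, Matrix.mul_assoc]
      _ = reflMatrix p q * (xᵀ * gram p q * x) * reflMatrix p q := by
          rw [← hJ, Matrix.mul_assoc (gram p q), reflMatrix_mul_self, Matrix.mul_one]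
          simp only [Matrix.mul_assoc]
      _ = gram p q := by
          rw [hx, ← hJ, Matrix.mul_assoc, reflMatrix_mul_self, Matrix.mul_one]
  let c : indefiniteSO p q → indefiniteSO p q := fun x =>
    ⟨⟨reflMatrix p q * x.1.1 * reflMatrix p q, by
      rw [Matrix.det_mul, Matrix.det_mul, x.1.2, mul_one, hdet]⟩, hpres _ x.2⟩
  have hc : Continuous c := by
    have hv : Continuous fun x : indefiniteSO p q => (x.1.1 : Matrix (Idx p q) (Idx p q) ℝ) :=
      continuous_subtype_val.comp continuous_subtype_val
    exact Continuous.subtype_mk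
      (Continuous.subtype_mk ((continuous_const.mul hv).mul continuous_const) _) _
  have hc1 : c 1 = 1 := by
    refine Subtype.ext (Subtype.ext ?_)
    change reflMatrix p q * 1 * reflMatrix p q = 1
    rw [Matrix.mul_one, reflMatrix_mul_self]
  obtain ⟨x, hx, hxg⟩ := g.2
  have hcx : c x ∈ connectedComponent (1 : indefiniteSO p q) := by
    have := hc.image_connectedComponent_subset 1 ⟨x, hx, rfl⟩
    rwa [hc1] at this
  refine ⟨⟨(c x).1, c x, hcx, rfl⟩, ?_⟩
  change reflMatrix p q * x.1.1 * reflMatrix p q = reflMatrix p q * g.1.1 * reflMatrix p q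
  rw [← hxg]
  rfl

/-- Conjugation with `diag(-1, 1, …, 1, -1)` is an automorphism of `G`. -/
lemma exists_reflMatrix_conj_automorphism (p q : ℕ) :
    ∃ σ : G p q ≃ₜ* G p q,
      ∀ g, mat (σ g) = reflMatrix p q * mat g * reflMatrix p q := by
  choose s hs using exists_mat_eq_reflMatrix_conj (p := p) (q := q)
  have hinv : Function.Involutive s := fun g => mat_injective <| by
    rw [hs, hs]
    calc _ = (reflMatrix p q * reflMatrix p q) * mat g * (reflMatrix p q * reflMatrix p q) := by
          simp only [Matrix.mul_assoc]
      _ = mat g := by rw [reflMatrix_mul_self, Matrix.one_mul, Matrix.mul_one]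
  have hcont : Continuous s := continuous_of_mat <| by
    simp only [hs]
    exact (continuous_const.mul continuous_mat).mul continuous_const
  refine ⟨{ toFun := s, invFun := s, left_inv := hinv, right_inv := hinv,
            map_mul' := fun g h => mat_injective ?_,
            continuous_toFun := hcont, continuous_invFun := hcont }, hs⟩
  rw [hs, mat_mul, mat_mul, hs, hs]
  calc _ = reflMatrix p q * mat g * 1 * mat h * reflMatrix p q := by
        rw [Matrix.mul_one, Matrix.mul_assoc _ (mat g)]
    _ = _ := by
        rw [← reflMatrix_mul_self]
        simp only [Matrix.mul_assoc]

lemma mem_fixedSubgroup_iff {σ : G p q ≃ₜ* G p q}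
    (hσ : ∀ g, mat (σ g) = reflMatrix p q * mat g * reflMatrix p q) {g : G p q} :
    g ∈ fixedSubgroup (σ : G p q →* G p q) ↔ Commute (mat g) (reflMatrix p q) := by
  have h1 : g ∈ fixedSubgroup (σ : G p q →* G p q) ↔ σ g = g := Iff.rfl
  rw [h1, ← mat_injective.eq_iff, hσ]
  constructor
  · intro h
    change mat g * reflMatrix p q = reflMatrix p q * mat g
    conv_lhs => rw [← h, Matrix.mul_assoc, reflMatrix_mul_self, Matrix.mul_one]
  · intro h
    rw [← h.eq, Matrix.mul_assoc, reflMatrix_mul_self, Matrix.mul_one]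

lemma commute_reflMatrix_of_commute_D0 {x : Matrix (Idx p q) (Idx p q) ℝ}
    (h : Commute x (D0 p q)) : Commute x (reflMatrix p q) := by
  rw [reflMatrix_eq]
  exact (Commute.one_right _).sub_right ((h.mul_right h).smul_right _)

/-- The diagonal entries at `0` and `d + 1` of an element of `G` fixed by the involution do not
vanish: the corresponding columns lie in the hyperbolic plane of `e₀` and `e_{d+1}`. -/
lemma apply_ne_zero_of_commute_reflMatrix {g : G p q}
    (hg : Commute (mat g) (reflMatrix p q)) :
    mat g (i0 p q) (i0 p q) ≠ 0 ∧ mat g (iLast p q) (iLast p q) ≠ 0 := by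
  have hcol : ∀ j : Idx p q, eta p q (mat g *ᵥ Pi.single j 1) (mat g *ᵥ Pi.single j 1) =
      ∑ i, mat g (Sum.inl i) j ^ 2 - ∑ i, mat g (Sum.inr i) j ^ 2 := by
    intro j
    rw [eta_self_eq_sum]
    simp
  have hz : ∀ i j : Idx p q, i ≠ i0 p q → i ≠ iLast p q → (j = i0 p q ∨ j = iLast p q) →
      mat g i j = 0 := fun i j h0 hl hj =>
    apply_eq_zero_of_commute_diagonal hg (reflMatrix_apply_ne h0 hl j hj)
  constructor
  · intro h
    have h1 := hcol (i0 p q)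
    rw [eta_mat_mulVec, eta_single_left, gram_mulVec_inl, Pi.single_eq_same,
      Finset.sum_eq_zero fun i _ => ?_] at h1
    · have := Finset.sum_nonneg fun i (_ : i ∈ Finset.univ) =>
        sq_nonneg (mat g (Sum.inr i) (i0 p q))
      linarith
    · by_cases hi : i = 0
      · rw [hi, h]; norm_num
      · rw [hz _ _ (Sum.inl_injective.ne hi) Sum.inl_ne_inr (Or.inl rfl)]; norm_num
  · intro h
    have h1 := hcol (iLast p q)
    rw [eta_mat_mulVec, eta_single_left, gram_mulVec_inr, Pi.single_eq_same,
      Finset.sum_eq_zero (f := fun i => mat g (Sum.inr i) (iLast p q) ^ 2) fun i _ => ?_] at h1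
    · have := Finset.sum_nonneg fun i (_ : i ∈ Finset.univ) =>
        sq_nonneg (mat g (Sum.inl i) (iLast p q))
      linarith
    · by_cases hi : i = Fin.last q
      · rw [hi, h]; norm_num
      · rw [hz _ _ Sum.inr_ne_inl (Sum.inr_injective.ne hi) (Or.inr rfl)]; norm_num

/-- The diagonal entries at `0` and `d + 1` are positive on the identity component of the group of
fixed points, as they are continuous, do not vanish, and are `1` at the identity. -/
lemma apply_pos_of_mem_connectedComponent {σ : G p q ≃ₜ* G p q}
    (hσ : ∀ g, mat (σ g) = reflMatrix p q * mat g * reflMatrix p q)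
    {y : fixedSubgroup (σ : G p q →* G p q)} (hy : y ∈ connectedComponent 1) {j : Idx p q}
    (hj : j = i0 p q ∨ j = iLast p q) : 0 < mat y.1 j j := by
  have hcont : Continuous fun z : fixedSubgroup (σ : G p q →* G p q) => mat z.1 j j :=
    (continuous_mat.comp continuous_subtype_val).matrix_elem j j
  have hne : ∀ z : fixedSubgroup (σ : G p q →* G p q), mat z.1 j j ≠ 0 := by
    intro z
    have := apply_ne_zero_of_commute_reflMatrix ((mem_fixedSubgroup_iff hσ).1 z.2)
    rcases hj with rfl | rfl
    exacts [this.1, this.2]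
  by_contra! hle
  have hpre := (isPreconnected_connectedComponent
    (x := (1 : fixedSubgroup (σ : G p q →* G p q)))).image _ hcont.continuousOn
  have h0 := hpre.Icc_subset ⟨y, hy, rfl⟩ ⟨1, mem_connectedComponent, rfl⟩
    (show (0 : ℝ) ∈ Set.Icc _ _ from ⟨hle, by simp⟩)
  obtain ⟨z, -, hz⟩ := h0
  exact hne z hz

/-- An orthogonal element of `G` fixed by the involution maps `e₀` and `e_{d+1}` to their multiples
with `±1`; if both signs are positive, it centralises `𝔞`. -/
lemma commute_D0_of_orthogonal {k : G p q} (hk : (mat k)ᵀ * mat k = 1)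
    (hkR : Commute (mat k) (reflMatrix p q)) (h0 : 0 < mat k (i0 p q) (i0 p q))
    (hl : 0 < mat k (iLast p q) (iLast p q)) : Commute (mat k) (D0 p q) := by
  have hk' : mat k * (mat k)ᵀ = 1 := mul_eq_one_comm.1 hk
  have hkJ : Commute (mat k) (gram p q) := by
    change mat k * gram p q = gram p q * mat k
    conv_rhs => rw [← Matrix.one_mul (gram p q), ← hk', Matrix.mul_assoc, Matrix.mul_assoc,
      ← Matrix.mul_assoc (mat k)ᵀ, mat_preserves]
  have hz : ∀ i j : Idx p q, i ≠ j → (j = i0 p q ∨ j = iLast p q) →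
      mat k i j = 0 ∧ mat k j i = 0 := by
    intro i j hij hj
    by_cases hi : i = i0 p q ∨ i = iLast p q
    · have hd : Sum.elim (fun _ : Fin (p + 1) => (1 : ℝ)) (fun _ : Fin (q + 1) => -1) i ≠
          Sum.elim (fun _ => 1) (fun _ => -1) j := by
        rcases hi with rfl | rfl <;> rcases hj with rfl | rfl
        · exact absurd rfl hij
        · norm_num
        · norm_num
        · exact absurd rfl hij
      exact ⟨apply_eq_zero_of_commute_diagonal hkJ hd,
        apply_eq_zero_of_commute_diagonal hkJ hd.symm⟩
    · have hd := reflMatrix_apply_ne (fun h => hi (Or.inl h)) (fun h => hi (Or.inr h)) j hj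
      exact ⟨apply_eq_zero_of_commute_diagonal hkR hd,
        apply_eq_zero_of_commute_diagonal hkR hd.symm⟩
  have hone : ∀ j : Idx p q, (j = i0 p q ∨ j = iLast p q) → 0 < mat k j j → mat k j j = 1 := by
    intro j hj hpos
    have h1 := congrFun (congrFun hk j) j
    rw [Matrix.mul_apply, Finset.sum_eq_single j, Matrix.transpose_apply, Matrix.one_apply_eq] at h1
    · nlinarith
    · intro i _ hij
      rw [(hz i j hij hj).1, mul_zero]
    · simp
  have hcol : ∀ i j : Idx p q, (j = i0 p q ∨ j = iLast p q) →
      mat k i j = (1 : Matrix (Idx p q) (Idx p q) ℝ) i j ∧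
      mat k j i = (1 : Matrix (Idx p q) (Idx p q) ℝ) j i := by
    intro i j hj
    by_cases hij : i = j
    · subst hij
      rw [Matrix.one_apply_eq]
      have : 0 < mat k i i := by rcases hj with rfl | rfl <;> assumption
      exact ⟨hone i hj this, hone i hj this⟩
    · rw [Matrix.one_apply_ne hij, Matrix.one_apply_ne (Ne.symm hij)]
      exact hz i j hij hj
  have hs : ∀ a b : Idx p q, (a = i0 p q ∨ a = iLast p q) → (b = i0 p q ∨ b = iLast p q) →
      Commute (mat k) (Matrix.single a b 1) := by
    intro a b ha hb
    have h1 : mat k * Matrix.single a b 1 = 1 * Matrix.single a b 1 := by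
      ext i j
      by_cases hj : j = b
      · subst hj
        rw [Matrix.mul_single_apply_same, Matrix.mul_single_apply_same, (hcol i a ha).1]
      · rw [Matrix.mul_single_apply_of_ne _ _ _ _ _ hj, Matrix.mul_single_apply_of_ne _ _ _ _ _ hj]
    have h2 : Matrix.single a b 1 * mat k = Matrix.single a b 1 * 1 := by
      ext i j
      by_cases hi : i = a
      · subst hi
        rw [Matrix.single_mul_apply_same, Matrix.single_mul_apply_same, (hcol j b hb).2]
      · rw [Matrix.single_mul_apply_of_ne _ _ _ _ _ hi, Matrix.single_mul_apply_of_ne _ _ _ _ _ hi]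
    change _ * _ = _ * _
    rw [h1, h2, Matrix.one_mul, Matrix.mul_one]
  exact (hs _ _ (Or.inl rfl) (Or.inr rfl)).add_right (hs _ _ (Or.inr rfl) (Or.inl rfl))

/-- If `g = k exp X` is the polar decomposition of an element of the identity component of the group
of fixed points, then `k` belongs to this component as well, hence centralises `𝔞`, and
`X = X' + t D₀` with `X' ∈ [𝔷, 𝔷]`, so that `g = (k exp X') exp (t D₀)`. -/
lemma mem_MA_of_mem_connectedComponent (hp : 2 ≤ p) {σ : G p q ≃ₜ* G p q}
    (hσ : ∀ g, mat (σ g) = reflMatrix p q * mat g * reflMatrix p q)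
    {y : fixedSubgroup (σ : G p q →* G p q)} (hy : y ∈ connectedComponent 1) :
    y.1 ∈ MA p q := by
  have hyR := (mem_fixedSubgroup_iff hσ).1 y.2
  have hyR' : Commute (mat y.1)ᵀ (reflMatrix p q) := by
    have := congrArg Matrix.transpose hyR.eq
    rw [Matrix.transpose_mul, Matrix.transpose_mul, reflMatrix, Matrix.diagonal_transpose] at this
    exact this.symm
  obtain ⟨X, hX, hXJ, hexp, hcomm⟩ := exists_exp_eq_transpose_mul_self y.1
  have hXR : Commute X (reflMatrix p q) := hcomm _ (hyR'.mul_left hyR)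
  choose e he using exists_mat_eq_exp hX hXJ
  -- The path from `g = k exp X` to `k` inside the group of fixed points.
  let γ : ℝ → fixedSubgroup (σ : G p q →* G p q) := fun t =>
    ⟨y.1 * e t, (mem_fixedSubgroup_iff hσ).2 <| by
      rw [mat_mul, he]
      exact hyR.mul_left (hXR.smul_left t).exp_left⟩
  have hγ : Continuous γ := by
    refine Continuous.subtype_mk (continuous_const.mul (continuous_of_mat ?_)) _
    simp only [he]
    exact continuous_exp_smul X
  have hγ0 : γ 0 = y := Subtype.ext <| mat_injective <| by
    change mat y.1 * mat (e 0) = _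
    rw [he, zero_smul, NormedSpace.exp_zero, Matrix.mul_one]
  have hγ1 : γ (-1) ∈ connectedComponent 1 := by
    rw [connectedComponent_eq hy]
    exact (isPreconnected_range hγ).subset_connectedComponent ⟨0, hγ0⟩ ⟨-1, rfl⟩
  have hk : mat (γ (-1)).1 = mat y.1 * NormedSpace.exp (-X) := by
    change mat y.1 * mat (e (-1)) = _
    rw [he, neg_one_smul]
  have hXneg : NormedSpace.exp (-X) * NormedSpace.exp X = 1 := by
    simpa using exp_mul_exp_neg (-X)
  have hkk : (mat (γ (-1)).1)ᵀ * mat (γ (-1)).1 = 1 := by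
    rw [hk, Matrix.transpose_mul, ← Matrix.exp_transpose, Matrix.transpose_neg, hX]
    calc _ = NormedSpace.exp (-X) * ((mat y.1)ᵀ * mat y.1) * NormedSpace.exp (-X) := by
          simp only [Matrix.mul_assoc]
      _ = (NormedSpace.exp (-X) * NormedSpace.exp X) *
          (NormedSpace.exp X * NormedSpace.exp (-X)) := by
          rw [← hexp, Matrix.exp_add_of_commute _ _ (Commute.refl X)]
          simp only [Matrix.mul_assoc]
      _ = 1 := by rw [hXneg, exp_mul_exp_neg, Matrix.one_mul]
  have hkD := commute_D0_of_orthogonal hkk ((mem_fixedSubgroup_iff hσ).1 (γ (-1)).2)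
    (apply_pos_of_mem_connectedComponent hσ hγ1 (Or.inl rfl))
    (apply_pos_of_mem_connectedComponent hσ hγ1 (Or.inr rfl))
  have hX' := sub_smul_D0_mem_derivedCentralizer hp hX hXJ hXR
  set t := X (i0 p q) (iLast p q)
  obtain ⟨a, ha⟩ := exists_mat_eq_exp (D0_transpose (p := p) (q := q)) gram_mul_D0_mul_gram t
  have hsplit : NormedSpace.exp X = NormedSpace.exp (X - t • D0 p q) * mat a := by
    rw [ha, ← Matrix.exp_add_of_commute _ _
      ((commute_of_mem_derivedCentralizer hX').smul_right t), sub_add_cancel]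
  have hmA : a ∈ A p q := Subgroup.subset_closure ⟨t, ha⟩
  have hmM : y.1 * a⁻¹ ∈ M p q := by
    refine Subgroup.subset_closure ⟨(γ (-1)).1, X - t • D0 p q, hkk, hkD, ?_, hX', ?_⟩
    · rw [Matrix.transpose_sub, Matrix.transpose_smul, hX, D0_transpose]
    · have h1 : mat a * mat a⁻¹ = 1 := by rw [← mat_mul, mul_inv_cancel, mat_one]
      calc mat (y.1 * a⁻¹) = mat y.1 * (NormedSpace.exp (-X) * NormedSpace.exp X) * mat a⁻¹ := by
            rw [hXneg, Matrix.mul_one, mat_mul]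
        _ = mat y.1 * NormedSpace.exp (-X) * NormedSpace.exp (X - t • D0 p q) *
            (mat a * mat a⁻¹) := by
            rw [hsplit]
            simp only [Matrix.mul_assoc]
        _ = _ := by rw [h1, Matrix.mul_one, hk]
  rw [← inv_mul_cancel_right y.1 a]
  exact mul_mem (Subgroup.mem_sup_left hmM) (Subgroup.mem_sup_right hmA)

lemma isSymmetricPair_MA (hp : 2 ≤ p) {σ : G p q ≃ₜ* G p q}
    (hσ : ∀ g, mat (σ g) = reflMatrix p q * mat g * reflMatrix p q) :
    IsSymmetricPair σ (MA p q) where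
  involutive g := mat_injective <| by
    rw [hσ, hσ]
    calc _ = (reflMatrix p q * reflMatrix p q) * mat g * (reflMatrix p q * reflMatrix p q) := by
          simp only [Matrix.mul_assoc]
      _ = mat g := by rw [reflMatrix_mul_self, Matrix.one_mul, Matrix.mul_one]
  component_le := by
    rintro _ ⟨y, hy, rfl⟩
    exact mem_MA_of_mem_connectedComponent hp hσ hy
  le_fixed h hh :=
    (mem_fixedSubgroup_iff hσ).2 (commute_reflMatrix_of_commute_D0 (commute_of_mem_MA hh))

end

end ConformalWard

theorem mainTheorem3 (p q : ℕ) (hqp : q ≤ p) (hd : 2 < p + q)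
    {𝕜 : Type*} [RCLike 𝕜] (V : Fin 4 → Type*) [∀ i, AddCommGroup (V i)] [∀ i, Module 𝕜 (V i)]
    [∀ i, FiniteDimensional 𝕜 (V i)]
    (π : ∀ i, Representation 𝕜 (ConformalWard.Q p q) (V i)) :
    -- there are diagonal choices of `w`
    (∃ w : ConformalWard.G p q, (ConformalWard.mat w).IsDiag ∧ ConformalWard.IsInversion w) ∧
    (∀ (w : ConformalWard.G p q) (hw : ConformalWard.IsInversion w),
      -- `F` is a matrix-spherical function
      (∀ f : ConformalWard.U p q → ⨂[𝕜] i, V i, ConformalWard.SatisfiesWard π f →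
        ConformalWard.IsMatrixSpherical (ConformalWard.MA p q)
          (ConformalWard.leftAction π hw) (ConformalWard.rightAction π hw)
          (ConformalWard.Gtilde p q) (ConformalWard.toSpherical hw f)) ∧
      -- `f ↦ F` is injective
      Set.InjOn (ConformalWard.toSpherical (W := ⨂[𝕜] i, V i) hw)
        {f | ConformalWard.SatisfiesWard π f} ∧
      -- the twisted actions are smooth if the `Q`-modules `V i` are
      ((∀ i, ConformalWard.IsSmooth 𝕜 (fun k : ConformalWard.Q p q => ConformalWard.entries k.1)
          (π i)) →
        ConformalWard.IsSmooth 𝕜 (fun h : ConformalWard.MA p q => ConformalWard.entries h.1)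
          (ConformalWard.leftAction π hw) ∧
        ConformalWard.IsSmooth 𝕜 (fun h : ConformalWard.MA p q => ConformalWard.entries h.1)
          (fun h => ConformalWard.rightAction π hw (MulOpposite.op h)))) ∧
    -- `(G, MA)` is a symmetric pair for the conjugation with `diag(-1, 1, …, 1, -1)`
    (∃ σ : ConformalWard.G p q ≃ₜ* ConformalWard.G p q,
      (∀ g, ConformalWard.mat (σ g) =
        ConformalWard.reflMatrix p q * ConformalWard.mat g * ConformalWard.reflMatrix p q) ∧
      ConformalWard.IsSymmetricPair σ (ConformalWard.MA p q)) := by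
  have hp : 2 ≤ p := by omega
  obtain ⟨σ, hσ⟩ := ConformalWard.exists_reflMatrix_conj_automorphism p q
  exact ⟨ConformalWard.exists_isDiag_isInversion (by omega),
    fun w hw => ⟨fun f hf => ConformalWard.isMatrixSpherical_toSpherical hw hf,
      ConformalWard.injOn_toSpherical (by omega) hw,
      fun hπ => ⟨ConformalWard.isSmooth_leftAction hw hπ,
        ConformalWard.isSmooth_rightAction hw hπ⟩⟩,
    σ, hσ, ConformalWard.isSymmetricPair_MA hp hσ⟩
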